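/- **Theorem (SOLIT for severely ill-posed problems).** *Model.* Let $\mathcal X,\mathcal Y$ be real separable Hilbert spaces and $T:\mathcal X\to\mathcal Y$ an injective Hilbert–Schmidt operator. Let $T^*Te_k=\lambda_ke_k$, where $(e_k)_{k\ge1}$ is an orthonormal basis of $\mathcal X$ and $\lambda_1\ge\lambda_2\ge\cdots>0$, with the normalization $\lambda_1\le e^{-1}$. Functions $g(T^*T)$ are defined through this decomposition. We observe $\langle Y,y\rangle=\langle Tf,y\rangle+\sigma\,\xi(y)$ for $y\in\mathcal Y$, where $\xi:\mathcal Y\to L^2(\Omega,P)$ is linear with $\xi(y)\sim N(0,\|y\|^2)$ (Gaussian white noise) and $\sigma>0$. Suppose that, for some $a\in\mathbb R$, $b>0$, $0<\vartheta\le 1/2$ and $0<c_{\min}\le c_{\max}$, $$c_{\min}k^{-a}e^{-bk^{\vartheta}}\le\lambda_k\le c_{\max}k^{-a}e^{-bk^{\vartheta}}\qquad\text{for all }k\ge 1 .$$ *Smoothness.* Let $\varphi(x)=\varphi_{\nu,\tau}(x)=x^{\nu}(-\log x)^{-\tau}$ for $0<x<1$, $\varphi(0)=0$, where either $\nu>0$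 and $\tau\in\mathbb R$, or $\nu=0$ and $\tau>0$. For $\rho>0$ let $\mathcal W_{\varphi}(\rho)=\{\varphi(T^*T)g:\ \|g\|\le\rho\}$. *Filter.* Let $\mathcal A\subset(0,\infty)$ have $0$ as an accumulation point. Let $(q_\alpha)_{\alpha\in\mathcal A}$ be an ordered filter: for all $x\in[0,\|T^*T\|]$ and $\alpha\in\mathcal A$, $q_\alpha(x)\ge0$, $\alpha q_\alpha(x)\le C'$ and $xq_\alpha(x)\le1$, and $q_\alpha(x)\le q_{\tilde\alpha}(x)$ whenever $\tilde\alpha\in\mathcal A$, $\tilde\alpha\le\alpha$. Put $\hat f_\alpha=q_\alpha(T^*T)T^*Y$ and $V(\alpha)=\sum_k\lambda_kq_\alpha(\lambda_k)^2$. Assume: 1. (Qualification) $\sup_{0\le x\le\|T^*T\|}\varphi(x)\,(1-xq_\alpha(x))\le C_\varphi\,\varphi(\alpha)$ for all $\alpha\in\mathcal A$ with $\alpha\le\lambda_1$. 2. (Smooth surrogate) With $\Sigma(x)=\#\{k:\lambda_k\ge x\}$ there is a continuous $S:(0,\lambda_1]\to[0,\infty)$ such that, for $\alpha\to0$ within $\mathcal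 A$, $\liminf S(\alpha)/\Sigma(\alpha)>0$ and $\alpha S(\alpha)\to0$, and, for some $C_S>0$, $\frac1\alpha\int_0^\alpha\Sigma(t)\,dt\le C_SS(\alpha)$ for all $\alpha\in\mathcal A$ with $\alpha\le\lambda_1$. 3. (Candidates) $\alpha_0>\alpha_1>\cdots$ is a sequence in $\mathcal A$, and $\theta_1\le V(\alpha_m)/V(\alpha_{m-1})\le\theta_2$ for all $m\ge1$, with constants $1<\theta_1\le\theta_2<\infty$. 4. (Variance lower bound) For some $c_{\rm v}>0$, $V(\alpha_m)\ge c_{\rm v}\,\dfrac{S(\alpha_m)}{(-\log\alpha_m)\,\alpha_m}$ for all $m\ge0$ with $\alpha_m\le\lambda_1$. *SOLIT.* Fix $\beta,\gamma>0$. Let $m_{\max}=\min\{m:\sigma^2V(\alpha_m)\ge1\}$, $v_m=\sigma^2V(\alpha_m)$, $x_m=2(1+\gamma)\log(v_{m+1}/v_0)$, and $v_{m_1,m_2}=\sigma^2\sum_k\lambda_k\,(q_{\alpha_{m_1}}(\lambda_k)-q_{\alpha_{m_2}}(\lambda_k))^2$. Let $z_{m_1,m_2}(x)\ge 0$ be the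 number with $P\bigl(\|(q_{\alpha_{m_1}}-q_{\alpha_{m_2}})(T^*T)T^*\xi\|>z_{m_1,m_2}(x)\bigr)=e^{-x}$. Let $\hat m$ be the least $m_1\in\{0,\dots,m_{\max}\}$ such that $$\|\hat f_{\alpha_{m_1}}-\hat f_{\alpha_{m_2}}\|\le\sigma z_{m_1,m_2}(x_{m_1})+\beta\sqrt{v_{m_1,m_2}}\qquad\text{for all } m_1<m_2\le m_{\max}.$$ *Conclusion.* There are constants $C>0$ and $\sigma_0\in(0,1)$, not depending on $\sigma$, $f$ or the realization $(\Omega,P,\xi)$ of the noise, such that for all $0<\sigma<\sigma_0$ $$\sup_{f\in\mathcal W_{\varphi_{\nu,\tau}}(\rho)}\mathbb E\bigl\|\hat f_{\alpha_{\hat m}}-f\bigr\|^2\le C\,(\sigma^2)^{\frac{2\nu}{2\nu+1}}\,(-\log\sigma^2)^{\frac{2\nu/\vartheta-2\tau}{2\nu+1}} .$$ -/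

import Mathlib

open MeasureTheory ProbabilityTheory Filter Topology Set
open scoped ENNReal NNReal

namespace Solit

noncomputable section

/-- `T` is Hilbert-Schmidt: `∑ ‖T b‖²` is finite for some orthonormal basis (equivalently for
every one, the sum being independent of the basis). -/
def IsHilbertSchmidt {X Y : Type*}
    [NormedAddCommGroup X] [InnerProductSpace ℝ X]
    [NormedAddCommGroup Y] [InnerProductSpace ℝ Y] (T : X →L[ℝ] Y) : Prop :=
  ∃ (s : Set X) (b : HilbertBasis s ℝ X), Summable fun i => ‖T (b i)‖ ^ 2

/-- An eigendecomposition of `T* T`: an orthonormal basis `(e_k)` of eigenvectors whose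
eigenvalues are listed in decreasing order with multiplicity.
The index `k : ℕ` stands for the `(k+1)`-st eigenvalue. -/
structure EigenDecomposition {X Y : Type*}
    [NormedAddCommGroup X] [InnerProductSpace ℝ X] [CompleteSpace X]
    [NormedAddCommGroup Y] [InnerProductSpace ℝ Y] [CompleteSpace Y] (T : X →L[ℝ] Y) where
  basis : HilbertBasis ℕ ℝ X
  eig : ℕ → ℝ
  apply_basis : ∀ k, (ContinuousLinearMap.adjoint T) (T (basis k)) = eig k • basis k
  antitone_eig : Antitone eig

/-- Standard Gaussian Hilbert space process (white noise) on `Y`: a linear map `ξ` into `L²(P)`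
with `ξ y ∼ N(0, ‖y‖²)`. By linearity all finite families `(ξ y₁, …, ξ yₙ)` are then jointly
Gaussian, with covariances `⟪yᵢ, yⱼ⟫`. -/
def IsWhiteNoise {Y : Type*} [NormedAddCommGroup Y] [InnerProductSpace ℝ Y]
    {Ω : Type*} [MeasurableSpace Ω] (P : Measure Ω) (ξ : Y →ₗ[ℝ] Lp ℝ 2 P) : Prop :=
  ∀ y : Y, HasLaw (fun ω => (ξ y : Ω → ℝ) ω) (gaussianReal 0 (‖y‖₊ ^ 2)) P

/-- The eigenvalue counting function `Σ(x) = #{k : λ_k ≥ x}`. -/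
def countEig (eig : ℕ → ℝ) (x : ℝ) : ℝ := ({k : ℕ | x ≤ eig k}.ncard : ℝ)

/-- The index function `φ_{ν,τ}(x) = x^ν (- log x)^{-τ}`. -/
def indexFun (ν τ x : ℝ) : ℝ := x ^ ν * (-Real.log x) ^ (-τ)

/-- Ordered filter `(q_α)_{α ∈ A}` on `[0, R]`, where `R = ‖T* T‖` in the application. -/
structure IsOrderedFilter (R : ℝ) (A : Set ℝ) (q : ℝ → ℝ → ℝ) : Prop where
  pos : ∀ α ∈ A, 0 < α
  accPt : AccPt (0 : ℝ) (𝓟 A)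
  nonneg : ∀ α ∈ A, ∀ x ∈ Icc 0 R, 0 ≤ q α x
  mul_le : ∃ C : ℝ, ∀ α ∈ A, ∀ x ∈ Icc 0 R, α * q α x ≤ C
  mul_le_one : ∀ α ∈ A, ∀ x ∈ Icc 0 R, x * q α x ≤ 1
  ordered : ∀ α ∈ A, ∀ α' ∈ A, α' ≤ α → ∀ x ∈ Icc 0 R, q α x ≤ q α' x

/-- `φ` is a qualification of the filter: `sup_{0 ≤ x ≤ R} φ(x) (1 - x q_α(x)) ≤ C φ(α)`.
It is required for `α ∈ A` with `α ≤ lam1` (the largest eigenvalue), where `φ(α)` is defined. -/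
def IsQualification (R lam1 : ℝ) (A : Set ℝ) (q : ℝ → ℝ → ℝ) (φ : ℝ → ℝ) : Prop :=
  ∃ C : ℝ, ∀ α ∈ A, α ≤ lam1 → ∀ x ∈ Icc 0 R, φ x * (1 - x * q α x) ≤ C * φ α

/-- `S : (0, λ₁] → [0, ∞)` is a smooth surrogate of the counting function `Σ`.
Limits `α → 0` are taken within `A`. The lower limit is formed in `[0, ∞]`, as the quotient may be
unbounded. -/
structure IsSmoothSurrogate (eig : ℕ → ℝ) (A : Set ℝ) (S : ℝ → ℝ) : Prop where
  continuousOn : ContinuousOn S (Ioc 0 (eig 0))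
  nonneg : ∀ x ∈ Ioc 0 (eig 0), 0 ≤ S x
  liminf_pos : 0 < liminf (fun α => ENNReal.ofReal (S α / countEig eig α)) (𝓝[A] (0 : ℝ))
  tendsto_zero : Tendsto (fun α => α * S α) (𝓝[A] (0 : ℝ)) (𝓝 0)
  integral_le : ∃ C > 0, ∀ α ∈ A, α ≤ eig 0 →
    (1 / α) * ∫ t in (0 : ℝ)..α, countEig eig t ≤ C * S α

/-- `V(α) = ∑ λ_k q_α(λ_k)²`, written for a single filter function `g = q_α`. -/
def varSum (eig : ℕ → ℝ) (g : ℝ → ℝ) : ℝ := ∑' k, eig k * g (eig k) ^ 2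

/-- `m_max = min {m : σ² V(α_m) ≥ 1}`. -/
def mMax (eig : ℕ → ℝ) (q : ℝ → ℝ → ℝ) (α : ℕ → ℝ) (σ : ℝ) : ℕ :=
  sInf {m : ℕ | 1 ≤ σ ^ 2 * varSum eig (q (α m))}

/-- The levels `x_m = 2 (1 + γ) log (v_{m+1} / v_0)`, `v_m = σ² V(α_m)`. -/
def level (eig : ℕ → ℝ) (q : ℝ → ℝ → ℝ) (α : ℕ → ℝ) (γ σ : ℝ) (m : ℕ) : ℝ :=
  2 * (1 + γ) * Real.log
    ((σ ^ 2 * varSum eig (q (α (m + 1)))) / (σ ^ 2 * varSum eig (q (α 0))))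

section Operators

variable {X Y : Type*}
  [NormedAddCommGroup X] [InnerProductSpace ℝ X] [CompleteSpace X]
  [NormedAddCommGroup Y] [InnerProductSpace ℝ Y] [CompleteSpace Y]
  {T : X →L[ℝ] Y}

/-- Functional calculus `g(T* T) x = ∑ g(λ_k) ⟪e_k, x⟫ e_k`. -/
def specOp (D : EigenDecomposition T) (g : ℝ → ℝ) (x : X) : X :=
  ∑' k, (g (D.eig k) * inner ℝ (D.basis k) x) • D.basis k

/-- The source set `W_φ(ρ) = {φ(T* T) g : ‖g‖ ≤ ρ}`. -/
def sourceSet (D : EigenDecomposition T) (φ : ℝ → ℝ) (ρ : ℝ) : Set X :=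
  {f | ∃ g : X, ‖g‖ ≤ ρ ∧ f = specOp D φ g}

/-- `g(T* T) T* Z` for a (generalized) random element `Z` of `Y`, given through its
evaluations `⟪Z, y⟫ = Z y : Ω → ℝ`; here `⟪T* Z, e_k⟫ = ⟪Z, T e_k⟫`. -/
def applyFilter {Ω : Type*} (D : EigenDecomposition T) (g : ℝ → ℝ) (Z : Y → Ω → ℝ) (ω : Ω) : X :=
  ∑' k, (g (D.eig k) * Z (T (D.basis k)) ω) • D.basis k

section Noise

variable {Ω : Type*} [MeasurableSpace Ω] {P : Measure Ω}

/-- The data in weak form: `⟪Y, y⟫ = ⟪T f, y⟫ + σ ξ(y)`. -/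
def observation (T : X →L[ℝ] Y) (ξ : Y →ₗ[ℝ] Lp ℝ 2 P) (σ : ℝ) (f : X) (y : Y) (ω : Ω) : ℝ :=
  inner ℝ (T f) y + σ * (ξ y : Ω → ℝ) ω

/-- The filter estimator `f̂_α = q_α(T* T) T* Y`, with `g = q_α`. -/
def estimator (D : EigenDecomposition T) (ξ : Y →ₗ[ℝ] Lp ℝ 2 P) (σ : ℝ) (f : X) (g : ℝ → ℝ)
    (ω : Ω) : X :=
  applyFilter D g (observation T ξ σ f) ω

/-- `‖ξ_{α₁} - ξ_{α₂}‖` with `ξ_α = q_α(T* T) T* ξ`, where `g₁ = q_{α₁}`, `g₂ = q_{α₂}`. -/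
def noiseDist (D : EigenDecomposition T) (ξ : Y →ₗ[ℝ] Lp ℝ 2 P) (g₁ g₂ : ℝ → ℝ) (ω : Ω) : ℝ :=
  ‖applyFilter D g₁ (fun y ω => (ξ y : Ω → ℝ) ω) ω
    - applyFilter D g₂ (fun y ω => (ξ y : Ω → ℝ) ω) ω‖

/-- The critical value `z(x)`, i.e. the `z ≥ 0` with `P(‖ξ_{α₁} - ξ_{α₂}‖ > z) = e^{-x}`,
as a quantile (the law of the norm has no atoms and a strictly increasing distribution function
on `[0, ∞)` as soon as `g₁` and `g₂` differ at some eigenvalue, so this `z` solves the equation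
and is the only solution). -/
def critValue (D : EigenDecomposition T) (ξ : Y →ₗ[ℝ] Lp ℝ 2 P) (g₁ g₂ : ℝ → ℝ) (x : ℝ) : ℝ :=
  sInf {z : ℝ | 0 ≤ z ∧ P {ω | z < noiseDist D ξ g₁ g₂ ω} ≤ ENNReal.ofReal (Real.exp (-x))}

/-- The threshold `σ z_{m₁,m₂}(x_{m₁}) + β √v_{m₁,m₂}` with
`v_{m₁,m₂} = σ² ∑ λ_k (q_{α_{m₁}}(λ_k) - q_{α_{m₂}}(λ_k))²`. -/
def threshold (D : EigenDecomposition T) (ξ : Y →ₗ[ℝ] Lp ℝ 2 P) (q : ℝ → ℝ → ℝ) (α : ℕ → ℝ)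
    (β γ σ : ℝ) (m₁ m₂ : ℕ) : ℝ :=
  σ * critValue D ξ (q (α m₁)) (q (α m₂)) (level D.eig q α γ σ m₁)
    + β * Real.sqrt (σ ^ 2 * varSum D.eig (fun x => q (α m₁) x - q (α m₂) x))

/-- The SOLIT index `m̂`: the least `m₁ ≤ m_max` such that
`‖f̂_{α_{m₁}} - f̂_{α_{m₂}}‖` is at most the threshold for all `m₁ < m₂ ≤ m_max`. -/
def solitIndex (D : EigenDecomposition T) (ξ : Y →ₗ[ℝ] Lp ℝ 2 P) (q : ℝ → ℝ → ℝ) (α : ℕ → ℝ)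
    (β γ σ : ℝ) (f : X) (ω : Ω) : ℕ :=
  sInf {m₁ : ℕ | m₁ ≤ mMax D.eig q α σ ∧ ∀ m₂, m₁ < m₂ → m₂ ≤ mMax D.eig q α σ →
    ‖estimator D ξ σ f (q (α m₁)) ω - estimator D ξ σ f (q (α m₂)) ω‖
      - threshold D ξ q α β γ σ m₁ m₂ ≤ 0}

/-- The SOLIT-tuned filter estimator `f̂_{α_{m̂}}`. -/
def solitEstimator (D : EigenDecomposition T) (ξ : Y →ₗ[ℝ] Lp ℝ 2 P) (q : ℝ → ℝ → ℝ) (α : ℕ → ℝ)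
    (β γ σ : ℝ) (f : X) (ω : Ω) : X :=
  estimator D ξ σ f (q (α (solitIndex D ξ q α β γ σ f ω))) ω

/-- The mean squared error `E ‖f̂_{α_{m̂}} - f‖²`, as an element of `[0, ∞]`. -/
def solitMSE (D : EigenDecomposition T) (ξ : Y →ₗ[ℝ] Lp ℝ 2 P) (q : ℝ → ℝ → ℝ) (α : ℕ → ℝ)
    (β γ σ : ℝ) (f : X) : ℝ≥0∞ :=
  ∫⁻ ω, ‖solitEstimator D ξ q α β γ σ f ω - f‖ₑ ^ 2 ∂P

end Noise

end Operators

end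

end Solit

/-! In the eigenbasis, `T* T` is diagonal. Each estimator error splits into a deterministic
residual, which shrinks as the filter grows, and a filtered noise whose squared norm is a quadratic
form in independent Gaussians. Exponential moments of this form give a fourth moment of order `V²`
and the deviation bound `2V + 4Mx`, where `M` bounds the single weights `λ_k g(λ_k)²`.

Let `n` be the first candidate beyond a fixed cutoff whose bias bound is at most a multiple of
`√v_n`. If `m̂ ≤ n`, then `m̂` was accepted against `n`, so the two estimators differ by at most the
threshold. This is `O(√v_n)`, because the deviation term `Mx` is `O(V)`: `M` is of order `1/α`, `x`
of order `log (1/α)`, and `V` at least of order `log (1/α)/α`. The last bound comes from `V ≥ c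
S/(log (1/α) α)` and a counting function of order at least `log² (1/α)`, which is where `ϑ ≤ 1/2`
enters.

If `m̂ = j + 1 > n`, then `j` was rejected. Geometric growth makes the variance of each difference
dominate `v_j`, so the `β` part of the threshold absorbs the bias and the noise itself must have
exceeded its critical value. By a union bound this has probability at most `m_max
(V_{j+1}/V_0)^{-2(1+γ)}`. Weighted with the error and summed over `j`, these events cost `O(σ²
m_max)`, that is `O(σ² log (1/σ²))`. The result is the oracle inequality
`IsGeometricFamily.solitMSE_le`.

The rate follows from the predecessor of `n`: its variance is at most a multiple of `φ(α)²` and of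
`σ² log^{1/ϑ} (1/α)/α`. The geometric mean that eliminates the powers of `α` gives the claimed rate
(`exists_balance_le_rate`), and the remaining terms are of smaller order. All constants are fixed
before the noise is introduced. -/

namespace Solit

/-! ### Parseval calculus in a Hilbert basis -/

section HilbertBasis

variable {E : Type*} [NormedAddCommGroup E] [InnerProductSpace ℝ E]

lemma hasSum_sq_inner_basis (b : HilbertBasis ℕ ℝ E) (x : E) :
    HasSum (fun k => inner ℝ (b k) x ^ 2) (‖x‖ ^ 2) := by
  have h := b.hasSum_inner_mul_inner x x
  rw [real_inner_self_eq_norm_sq] at h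
  have he : (fun k => inner ℝ (b k) x ^ 2) = fun k => inner ℝ x (b k) * inner ℝ (b k) x := by
    funext k
    rw [real_inner_comm (b k) x, sq]
  rw [he]
  exact h

/-- Square summable coefficients define a vector. -/
lemma exists_hasSum_of_summable_sq [CompleteSpace E] (b : HilbertBasis ℕ ℝ E) {c : ℕ → ℝ}
    (hc : Summable fun k => c k ^ 2) :
    HasSum (fun k => c k • b k) (∑' k, c k • b k) ∧
      ∀ k, inner ℝ (b k) (∑' k, c k • b k) = c k := by
  have hmem : Memℓp c 2 := by
    refine memℓp_gen ?_
    simpa using hc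
  have hs := b.hasSum_repr_symm ⟨c, hmem⟩
  have hs' : HasSum (fun k => c k • b k) (b.repr.symm ⟨c, hmem⟩) := hs
  rw [hs'.tsum_eq]
  refine ⟨hs', fun k => ?_⟩
  rw [← b.repr_apply_apply]
  simp

lemma norm_le_of_abs_inner_le (b : HilbertBasis ℕ ℝ E) {x y : E} {M : ℝ} (hM : 0 ≤ M)
    (h : ∀ k, |inner ℝ (b k) x| ≤ M * |inner ℝ (b k) y|) : ‖x‖ ≤ M * ‖y‖ := by
  refine le_of_abs_le (abs_le_of_sq_le_sq ?_ (by positivity))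
  rw [mul_pow]
  refine hasSum_le (fun k => ?_) (hasSum_sq_inner_basis b x)
    ((hasSum_sq_inner_basis b y).mul_left (M ^ 2))
  rw [← mul_pow]
  refine sq_le_sq.2 ?_
  rw [abs_mul, abs_of_nonneg hM]
  exact h k

lemma hilbertBasis_ext (b : HilbertBasis ℕ ℝ E) {x y : E}
    (h : ∀ k, inner ℝ (b k) x = (inner ℝ (b k) y : ℝ)) : x = y := by
  apply b.repr.injective
  ext k
  rw [b.repr_apply_apply, b.repr_apply_apply, h]

end HilbertBasis

/-! ### Exponential moments of Gaussian quadratic forms -/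

section Gaussian

/-- Exponential moment of the square of a centred Gaussian variable. -/
lemma lintegral_exp_sq_gaussianReal_le {v : ℝ≥0} {s : ℝ} (hs : 0 ≤ s) (hsv : s * v ≤ 1 / 4) :
    ∫⁻ x, ENNReal.ofReal (Real.exp (s * x ^ 2)) ∂(gaussianReal 0 v)
      ≤ ENNReal.ofReal (Real.exp (2 * s * v)) := by
  by_cases hv : v = 0
  · subst hv
    rw [gaussianReal_zero_var, lintegral_dirac' _ (by fun_prop)]
    simp
  have hvpos : (0 : ℝ) < v := by positivity
  have hb : 0 < 1 / (2 * v) - s := by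
    rw [sub_pos, lt_div_iff₀ (by positivity)]
    nlinarith
  have hprod : ∀ x : ℝ, gaussianPDFReal 0 v x * Real.exp (s * x ^ 2)
      = (√(2 * Real.pi * v))⁻¹ * Real.exp (-(1 / (2 * v) - s) * x ^ 2) := by
    intro x
    rw [gaussianPDFReal, mul_assoc, ← Real.exp_add]
    congr 2
    field_simp
    ring
  rw [gaussianReal_of_var_ne_zero 0 hv, lintegral_withDensity_eq_lintegral_mul _
    (measurable_gaussianPDF 0 v) (by fun_prop)]
  have hfun : ∀ x : ℝ, (gaussianPDF 0 v * fun x => ENNReal.ofReal (Real.exp (s * x ^ 2))) x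
      = ENNReal.ofReal ((√(2 * Real.pi * v))⁻¹ * Real.exp (-(1 / (2 * v) - s) * x ^ 2)) := by
    intro x
    rw [Pi.mul_apply, gaussianPDF, ← ENNReal.ofReal_mul (gaussianPDFReal_nonneg 0 v x), hprod]
  rw [lintegral_congr hfun, ← ofReal_integral_eq_lintegral_ofReal
    ((integrable_exp_neg_mul_sq hb).const_mul _)
    (Eventually.of_forall fun x => by positivity), integral_const_mul, integral_gaussian]
  refine ENNReal.ofReal_le_ofReal ?_
  rw [← Real.sqrt_inv, ← Real.sqrt_mul (by positivity)]
  refine Real.sqrt_le_iff.2 ⟨by positivity, ?_⟩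
  -- The integral equals `(1 - u)^{-1/2}` with `u = 2sv ≤ 1/2`, and there `1/(1 - u) ≤ 1 + 2u ≤ exp
  -- (2u)`.
  have hu : 0 < 1 - 2 * s * v := by nlinarith
  have h1 : (2 * Real.pi * v)⁻¹ * (Real.pi / (1 / (2 * v) - s)) = 1 / (1 - 2 * s * v) := by
    have : (1 : ℝ) / (2 * v) - s = (1 - 2 * s * v) / (2 * v) := by field_simp
    rw [this]
    field_simp
  rw [h1, ← Real.exp_nat_mul, div_le_iff₀ hu]
  have h2 := Real.add_one_le_exp (((2 : ℕ) : ℝ) * (2 * s * v))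
  push_cast at h2 ⊢
  have h0 : 0 ≤ s * v := by positivity
  nlinarith

variable {Ω : Type*} [MeasurableSpace Ω] {P : Measure Ω}

/-- Integrate `y² ≤ 2 exp y` at `y = tF`. -/
lemma lintegral_ofReal_sq_le_of_exp {F : Ω → ℝ} (hF : ∀ ω, 0 ≤ F ω) {t K : ℝ} (ht : 0 < t)
    (h : ∫⁻ ω, ENNReal.ofReal (Real.exp (t * F ω)) ∂P ≤ ENNReal.ofReal K) :
    ∫⁻ ω, ENNReal.ofReal (F ω ^ 2) ∂P ≤ ENNReal.ofReal (2 / t ^ 2 * K) := by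
  have hpt : ∀ ω, ENNReal.ofReal (F ω ^ 2)
      ≤ ENNReal.ofReal (2 / t ^ 2) * ENNReal.ofReal (Real.exp (t * F ω)) := by
    intro ω
    rw [← ENNReal.ofReal_mul (by positivity)]
    refine ENNReal.ofReal_le_ofReal ?_
    have h1 := Real.quadratic_le_exp_of_nonneg (mul_nonneg ht.le (hF ω))
    have h2 : 0 ≤ t * F ω := mul_nonneg ht.le (hF ω)
    rw [div_mul_eq_mul_div, le_div_iff₀ (by positivity)]
    nlinarith
  calc ∫⁻ ω, ENNReal.ofReal (F ω ^ 2) ∂P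
      ≤ ∫⁻ ω, ENNReal.ofReal (2 / t ^ 2) * ENNReal.ofReal (Real.exp (t * F ω)) ∂P :=
        lintegral_mono hpt
    _ = ENNReal.ofReal (2 / t ^ 2) * ∫⁻ ω, ENNReal.ofReal (Real.exp (t * F ω)) ∂P :=
        lintegral_const_mul' _ _ ENNReal.ofReal_ne_top
    _ ≤ ENNReal.ofReal (2 / t ^ 2) * ENNReal.ofReal K := by gcongr
    _ = _ := by rw [← ENNReal.ofReal_mul (by positivity)]

/-- Chernoff bound: Markov's inequality applied to `exp (tF)`. -/
lemma measure_lt_le_of_exp {F : Ω → ℝ} (hFm : Measurable F) {t K u x : ℝ} (ht : 0 < t)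
    (h : ∫⁻ ω, ENNReal.ofReal (Real.exp (t * F ω)) ∂P ≤ ENNReal.ofReal (Real.exp K))
    (hu : K + x ≤ t * u) :
    P {ω | u < F ω} ≤ ENNReal.ofReal (Real.exp (-x)) := by
  have hM := mul_meas_ge_le_lintegral (μ := P)
    (f := fun ω => ENNReal.ofReal (Real.exp (t * F ω))) (by fun_prop)
    (ENNReal.ofReal (Real.exp (t * u)))
  have hsub : {ω | u < F ω}
      ⊆ {ω | ENNReal.ofReal (Real.exp (t * u)) ≤ ENNReal.ofReal (Real.exp (t * F ω))} := by
    intro ω hω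
    have hω' : u < F ω := hω
    refine ENNReal.ofReal_le_ofReal (Real.exp_le_exp.2 ?_)
    nlinarith
  have h3 : ENNReal.ofReal (Real.exp (t * u)) * P {ω | u < F ω} ≤ ENNReal.ofReal (Real.exp K) :=
    (mul_le_mul_right (measure_mono hsub) _).trans (hM.trans h)
  have h4 : ENNReal.ofReal (Real.exp K)
      ≤ ENNReal.ofReal (Real.exp (t * u)) * ENNReal.ofReal (Real.exp (-x)) := by
    rw [← ENNReal.ofReal_mul (Real.exp_nonneg _), ← Real.exp_add]
    refine ENNReal.ofReal_le_ofReal (Real.exp_le_exp.2 (by linarith))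
  exact (ENNReal.mul_le_mul_iff_right (ENNReal.ofReal_pos.2 (Real.exp_pos _)).ne'
    ENNReal.ofReal_ne_top).1 (h3.trans h4)

/-- Independence factorizes the exponential of the sum; each factor is a one-dimensional Gaussian
integral. -/
lemma lintegral_exp_sum_sq_le {G : ℕ → Ω → ℝ} (hGm : ∀ k, Measurable (G k)) {lam : ℕ → ℝ≥0}
    (hG : ∀ k, HasLaw (G k) (gaussianReal 0 (lam k)) P)
    (hind : ∀ n, iIndepFun (fun i : Fin n => G i) P)
    {w : ℕ → ℝ} (hw : ∀ k, 0 ≤ w k) {t : ℝ} (ht : 0 ≤ t)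
    (htw : ∀ k, t * (w k * lam k) ≤ 1 / 4) (n : ℕ) :
    ∫⁻ ω, ENNReal.ofReal (Real.exp (t * ∑ k ∈ Finset.range n, w k * G k ω ^ 2)) ∂P
      ≤ ENNReal.ofReal (Real.exp (2 * t * ∑ k ∈ Finset.range n, w k * lam k)) := by
  have hX : iIndepFun (fun (i : Fin n) ω =>
      ENNReal.ofReal (Real.exp ((t * w i) * G i ω ^ 2))) P :=
    (hind n).comp (fun (i : Fin n) (x : ℝ) => ENNReal.ofReal (Real.exp ((t * w i) * x ^ 2)))
      (fun i => by fun_prop)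
  have hprod := lintegral_prod_eq_prod_lintegral_of_indepFun Finset.univ _ hX
    (fun i => by have := hGm i; fun_prop)
  have h1 : ∀ ω, ENNReal.ofReal (Real.exp (t * ∑ k ∈ Finset.range n, w k * G k ω ^ 2))
      = ∏ i : Fin n, ENNReal.ofReal (Real.exp ((t * w i) * G i ω ^ 2)) := by
    intro ω
    rw [← ENNReal.ofReal_prod_of_nonneg (fun i _ => Real.exp_nonneg _), ← Real.exp_sum,
      ← Fin.sum_univ_eq_sum_range (fun k => w k * G k ω ^ 2), Finset.mul_sum]
    simp only [mul_assoc]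
  rw [lintegral_congr h1, hprod, ← Fin.sum_univ_eq_sum_range (fun k => w k * (lam k : ℝ)),
    Finset.mul_sum, Real.exp_sum, ENNReal.ofReal_prod_of_nonneg (fun i _ => Real.exp_nonneg _)]
  refine Finset.prod_le_prod' fun i _ => ?_
  have h2 := (hG i).lintegral_comp
    (f := fun x => ENNReal.ofReal (Real.exp ((t * w i) * x ^ 2))) (by fun_prop)
  rw [h2]
  refine (lintegral_exp_sq_gaussianReal_le (mul_nonneg ht (hw i)) ?_).trans_eq ?_
  · rw [mul_assoc]; exact htw i
  · congr 2; ring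

/-- A Gaussian quadratic form converges almost surely and has an exponential moment. -/
lemma summable_and_lintegral_exp_le {G : ℕ → Ω → ℝ} (hGm : ∀ k, Measurable (G k)) {lam : ℕ → ℝ≥0}
    (hG : ∀ k, HasLaw (G k) (gaussianReal 0 (lam k)) P)
    (hind : ∀ n, iIndepFun (fun i : Fin n => G i) P)
    {w : ℕ → ℝ} (hw : ∀ k, 0 ≤ w k) (hwl : Summable fun k => w k * lam k) {t : ℝ} (ht : 0 < t)
    (htw : ∀ k, t * (w k * lam k) ≤ 1 / 4) :
    (∀ᵐ ω ∂P, Summable fun k => w k * G k ω ^ 2) ∧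
    ∫⁻ ω, ENNReal.ofReal (Real.exp (t * ∑' k, w k * G k ω ^ 2)) ∂P
      ≤ ENNReal.ofReal (Real.exp (2 * t * ∑' k, w k * lam k)) := by
  set F : ℕ → Ω → ℝ≥0∞ := fun n ω =>
    ENNReal.ofReal (Real.exp (t * ∑ k ∈ Finset.range n, w k * G k ω ^ 2)) with hF
  have hnn : ∀ ω k, 0 ≤ w k * G k ω ^ 2 := fun ω k => mul_nonneg (hw k) (sq_nonneg _)
  have hFm : ∀ n, Measurable (F n) := fun n => by fun_prop
  have hmono : Monotone F := by
    intro m n hmn ω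
    refine ENNReal.ofReal_le_ofReal (Real.exp_le_exp.2 (mul_le_mul_of_nonneg_left ?_ ht.le))
    exact Finset.sum_le_sum_of_subset_of_nonneg (Finset.range_mono hmn) fun k _ _ => hnn ω k
  -- Monotone convergence serves twice: an integrable supremum is finite almost surely, hence the
  -- partial sums are bounded, and it dominates the exponential of the full series.
  have hsup : ∫⁻ ω, ⨆ n, F n ω ∂P
      ≤ ENNReal.ofReal (Real.exp (2 * t * ∑' k, w k * lam k)) := by
    rw [lintegral_iSup hFm hmono]
    refine iSup_le fun n => (lintegral_exp_sum_sq_le hGm hG hind hw ht.le htw n).trans ?_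
    refine ENNReal.ofReal_le_ofReal (Real.exp_le_exp.2 (mul_le_mul_of_nonneg_left ?_ (by positivity)))
    exact hwl.sum_le_tsum _ fun k _ => mul_nonneg (hw k) (lam k).2
  have hfin : ∀ᵐ ω ∂P, ⨆ n, F n ω < ∞ :=
    ae_lt_top (.iSup hFm) (hsup.trans_lt ENNReal.ofReal_lt_top).ne
  have hsum : ∀ᵐ ω ∂P, Summable fun k => w k * G k ω ^ 2 := by
    filter_upwards [hfin] with ω hω
    refine summable_of_sum_range_le (c := (⨆ n, F n ω).toReal / t) (hnn ω) fun n => ?_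
    rw [le_div_iff₀ ht]
    have h1 : F n ω ≤ ⨆ n, F n ω := le_iSup (fun n => F n ω) n
    have h2 := (ENNReal.ofReal_le_iff_le_toReal hω.ne).1 h1
    have h3 := Real.add_one_le_exp (t * ∑ k ∈ Finset.range n, w k * G k ω ^ 2)
    linarith
  refine ⟨hsum, le_trans (lintegral_mono_ae ?_) hsup⟩
  filter_upwards [hsum] with ω hω
  have hlim : Tendsto (fun n => F n ω) atTop
      (𝓝 (ENNReal.ofReal (Real.exp (t * ∑' k, w k * G k ω ^ 2)))) :=
    ENNReal.tendsto_ofReal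
      (((Real.continuous_exp.tendsto _).comp (hω.hasSum.tendsto_sum_nat.const_mul t)))
  exact le_of_tendsto' hlim fun n => le_iSup (fun n => F n ω) n

end Gaussian

/-! ### Independence of white noise along orthogonal vectors -/

section WhiteNoise

variable {Y : Type*} [NormedAddCommGroup Y] [InnerProductSpace ℝ Y]
  {Ω : Type*} [MeasurableSpace Ω] {P : Measure Ω}

lemma charFun_real_map_one {Z : Ω → ℝ} (hZ : AEMeasurable Z P) :
    charFun (P.map Z) 1 = ∫ ω, Complex.exp (Z ω * Complex.I) ∂P := by
  rw [charFun_apply, integral_map hZ (by fun_prop)]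
  simp

variable [IsProbabilityMeasure P] in
/-- White noise is independent along orthogonal families. -/
lemma IsWhiteNoise.iIndepFun {ξ : Y →ₗ[ℝ] Lp ℝ 2 P} (hξ : IsWhiteNoise P ξ) {n : ℕ}
    {y : Fin n → Y} (hy : Pairwise fun i j => inner ℝ (y i) (y j) = (0 : ℝ)) :
    iIndepFun (fun i ω => (ξ (y i) : Ω → ℝ) ω) P := by
  rw [iIndepFun_iff_charFun_pi fun i => (hξ (y i)).aemeasurable]
  intro t
  have hm : ∀ i, AEMeasurable (fun ω => (ξ (y i) : Ω → ℝ) ω) P := fun i => (hξ (y i)).aemeasurable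
  -- Linearity turns a combination of values of the noise into one value, which is Gaussian. By
  -- Pythagoras its variance is additive, so the joint characteristic function factorizes.
  have hlin : (fun ω => ∑ i, t i * (ξ (y i) : Ω → ℝ) ω)
      =ᵐ[P] fun ω => (ξ (∑ i, t i • y i) : Ω → ℝ) ω := by
    rw [map_sum]
    have h1 := Lp.coeFn_finsetSum (p := 2) (μ := P) Finset.univ (fun i => ξ (t i • y i))
    have h2 : ∀ᵐ ω ∂P, ∀ i, (ξ (t i • y i) : Ω → ℝ) ω = t i * (ξ (y i) : Ω → ℝ) ω := by
      rw [ae_all_iff]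
      intro i
      rw [map_smul]
      filter_upwards [Lp.coeFn_smul (t i) (ξ (y i))] with ω hω
      rw [hω]; simp
    filter_upwards [h1, h2] with ω h1 h2
    rw [h1, Finset.sum_apply]
    exact Finset.sum_congr rfl fun i _ => (h2 i).symm
  have hnorm : ‖∑ i, t i • y i‖ ^ 2 = ∑ i, t i ^ 2 * ‖y i‖ ^ 2 := by
    rw [← real_inner_self_eq_norm_sq, sum_inner]
    refine Finset.sum_congr rfl fun i _ => ?_
    rw [inner_sum, Finset.sum_eq_single i]
    · rw [real_inner_smul_left, real_inner_smul_right, real_inner_self_eq_norm_sq]; ring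
    · intro j _ hji
      rw [real_inner_smul_left, real_inner_smul_right, hy hji.symm]; simp
    · simp
  have hL : charFun (P.map fun ω => WithLp.toLp 2 fun i => (ξ (y i) : Ω → ℝ) ω) t
      = ∫ ω, Complex.exp ((∑ i, t i * (ξ (y i) : Ω → ℝ) ω : ℝ) * Complex.I) ∂P := by
    rw [charFun_apply, integral_map (by fun_prop) (by fun_prop)]
    simp [PiLp.inner_apply]
  have hsum : AEMeasurable (fun ω => ∑ i, t i * (ξ (y i) : Ω → ℝ) ω) P := by fun_prop
  rw [hL, ← charFun_real_map_one hsum, Measure.map_congr hlin, (hξ _).map_eq,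
    charFun_gaussianReal]
  simp_rw [(hξ _).map_eq, charFun_gaussianReal]
  rw [← Complex.exp_sum]
  congr 1
  have hc : ((‖∑ i, t i • y i‖ : ℂ)) ^ 2 = ∑ i, (t i : ℂ) ^ 2 * (‖y i‖ : ℂ) ^ 2 := by
    exact_mod_cast congrArg (fun r : ℝ => (r : ℂ)) hnorm
  simp [hc, Finset.sum_div, ← Finset.sum_neg_distrib, mul_comm]

end WhiteNoise

/-! ### Residuals and filtered noise in the eigenbasis -/

section Spectral

variable {X Y : Type*}
  [NormedAddCommGroup X] [InnerProductSpace ℝ X] [CompleteSpace X]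
  [NormedAddCommGroup Y] [InnerProductSpace ℝ Y] [CompleteSpace Y]
  {T : X →L[ℝ] Y} (D : EigenDecomposition T)

lemma EigenDecomposition.inner_apply_basis (f : X) (k : ℕ) :
    inner ℝ (T f) (T (D.basis k)) = D.eig k * inner ℝ (D.basis k) f := by
  rw [← ContinuousLinearMap.adjoint_inner_right, D.apply_basis, real_inner_smul_right,
    real_inner_comm]

lemma EigenDecomposition.norm_apply_basis_sq (k : ℕ) : ‖T (D.basis k)‖ ^ 2 = D.eig k := by
  rw [← real_inner_self_eq_norm_sq, D.inner_apply_basis, real_inner_self_eq_norm_sq,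
    D.basis.orthonormal.1 k]
  simp

lemma EigenDecomposition.eig_nonneg (k : ℕ) : 0 ≤ D.eig k := by
  rw [← D.norm_apply_basis_sq]; positivity

lemma EigenDecomposition.eig_mem_Icc (k : ℕ) :
    D.eig k ∈ Icc 0 ‖(ContinuousLinearMap.adjoint T) ∘L T‖ := by
  refine ⟨D.eig_nonneg k, ?_⟩
  have h := ((ContinuousLinearMap.adjoint T) ∘L T).le_opNorm (D.basis k)
  rw [ContinuousLinearMap.comp_apply, D.apply_basis, norm_smul, D.basis.orthonormal.1 k] at h
  simpa [abs_of_nonneg (D.eig_nonneg k)] using h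

lemma EigenDecomposition.pairwise_inner_apply_basis {i j : ℕ} (hij : i ≠ j) :
    inner ℝ (T (D.basis i)) (T (D.basis j)) = (0 : ℝ) := by
  rw [D.inner_apply_basis, D.basis.orthonormal.2 hij.symm, mul_zero]

/-- Boundedness on the spectrum keeps the coefficients square summable, which rules out the junk
value of `tsum` in `specOp`. -/
lemma inner_specOp {g : ℝ → ℝ} {M : ℝ} (hg : ∀ k, |g (D.eig k)| ≤ M) (x : X) (k : ℕ) :
    inner ℝ (D.basis k) (specOp D g x) = g (D.eig k) * inner ℝ (D.basis k) x := by
  refine (exists_hasSum_of_summable_sq D.basis ?_).2 k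
  refine Summable.of_nonneg_of_le (fun k => sq_nonneg _) (fun k => ?_)
    ((hasSum_sq_inner_basis D.basis x).summable.mul_left (M ^ 2))
  rw [mul_pow]
  refine mul_le_mul_of_nonneg_right ?_ (sq_nonneg _)
  rw [← sq_abs]
  exact pow_le_pow_left₀ (abs_nonneg _) (hg k) 2

/-- The regularization error `(1 - x g(x))(T* T) f`. -/
noncomputable def residual (g : ℝ → ℝ) (f : X) : X := specOp D (fun x => 1 - x * g x) f

/-- `g` is an admissible filter on the spectrum of `T* T`. -/
structure IsSpectralFilter (g : ℝ → ℝ) : Prop where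
  nonneg : ∀ k, 0 ≤ g (D.eig k)
  mul_le_one : ∀ k, D.eig k * g (D.eig k) ≤ 1
  summable : Summable fun k => D.eig k * g (D.eig k) ^ 2

variable {D} {g g₁ g₂ : ℝ → ℝ}

lemma IsSpectralFilter.abs_residual_le (hg : IsSpectralFilter D g) (k : ℕ) :
    |1 - D.eig k * g (D.eig k)| ≤ 1 := by
  have h1 := hg.mul_le_one k
  have h2 := mul_nonneg (D.eig_nonneg k) (hg.nonneg k)
  rw [abs_le]; constructor <;> linarith

lemma IsSpectralFilter.inner_residual (hg : IsSpectralFilter D g) (f : X) (k : ℕ) :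
    inner ℝ (D.basis k) (residual D g f)
      = (1 - D.eig k * g (D.eig k)) * inner ℝ (D.basis k) f :=
  inner_specOp D hg.abs_residual_le f k

/-- Bias decreases along the filter order, because `0 ≤ 1 - λ g₂ ≤ 1 - λ g₁` on the spectrum. -/
lemma IsSpectralFilter.norm_residual_le (hg₁ : IsSpectralFilter D g₁)
    (hg₂ : IsSpectralFilter D g₂) (h : ∀ k, g₁ (D.eig k) ≤ g₂ (D.eig k)) (f : X) :
    ‖residual D g₂ f‖ ≤ ‖residual D g₁ f‖ := by
  rw [← one_mul ‖residual D g₁ f‖]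
  refine norm_le_of_abs_inner_le D.basis zero_le_one fun k => ?_
  rw [one_mul, hg₁.inner_residual, hg₂.inner_residual, abs_mul, abs_mul]
  refine mul_le_mul_of_nonneg_right ?_ (abs_nonneg _)
  have h1 := hg₁.mul_le_one k
  have h2 := hg₂.mul_le_one k
  have h3 := mul_le_mul_of_nonneg_left (h k) (D.eig_nonneg k)
  rw [abs_of_nonneg (by linarith), abs_of_nonneg (by linarith)]
  linarith

/-- The multiplier `λ (g₂ - g₁)` lies between `0` and `1 - λ g₁`, since `λ g₂ ≤ 1`. Hence comparing
two estimators involves only the bias of the smoother one. -/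
lemma IsSpectralFilter.norm_residual_sub_le (hg₁ : IsSpectralFilter D g₁)
    (hg₂ : IsSpectralFilter D g₂) (h : ∀ k, g₁ (D.eig k) ≤ g₂ (D.eig k)) (f : X) :
    ‖residual D g₁ f - residual D g₂ f‖ ≤ ‖residual D g₁ f‖ := by
  rw [← one_mul ‖residual D g₁ f‖]
  refine norm_le_of_abs_inner_le D.basis zero_le_one fun k => ?_
  rw [one_mul, inner_sub_right, hg₁.inner_residual, hg₂.inner_residual, ← sub_mul, abs_mul,
    abs_mul]
  refine mul_le_mul_of_nonneg_right ?_ (abs_nonneg _)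
  have h1 := hg₁.mul_le_one k
  have h2 := hg₂.mul_le_one k
  have h3 := mul_le_mul_of_nonneg_left (h k) (D.eig_nonneg k)
  rw [abs_of_nonneg (by linarith), abs_of_nonneg (by linarith)]
  linarith

lemma IsSpectralFilter.norm_residual_specOp_le (hg : IsSpectralFilter D g) {φ : ℝ → ℝ} {B M : ℝ}
    (hφ : ∀ k, |φ (D.eig k)| ≤ B) (hM : 0 ≤ M)
    (hq : ∀ k, |φ (D.eig k) * (1 - D.eig k * g (D.eig k))| ≤ M) (h : X) :
    ‖residual D g (specOp D φ h)‖ ≤ M * ‖h‖ := by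
  refine norm_le_of_abs_inner_le D.basis hM fun k => ?_
  rw [hg.inner_residual, inner_specOp D hφ, ← mul_assoc, abs_mul, mul_comm (1 - _)]
  exact mul_le_mul_of_nonneg_right (hq k) (abs_nonneg _)

section Noise

variable {Ω : Type*} [MeasurableSpace Ω] {P : Measure Ω} (ξ : Y →ₗ[ℝ] Lp ℝ 2 P)

variable (D) in
/-- The squared norm `∑ g(λ_k)² ξ(T e_k)²` of the filtered noise. -/
noncomputable def noiseSq (g : ℝ → ℝ) (ω : Ω) : ℝ :=
  ∑' k, g (D.eig k) ^ 2 * (ξ (T (D.basis k)) : Ω → ℝ) ω ^ 2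

variable (D) in
/-- The filtered noise `g(T* T) T* ξ`. -/
noncomputable def filteredNoise (g : ℝ → ℝ) (ω : Ω) : X :=
  applyFilter D g (fun y ω => (ξ y : Ω → ℝ) ω) ω

variable (D) in
/-- The series defining the filtered noise converges at `ω`. -/
def NoiseSummable (g : ℝ → ℝ) (ω : Ω) : Prop :=
  Summable fun k => g (D.eig k) ^ 2 * (ξ (T (D.basis k)) : Ω → ℝ) ω ^ 2

lemma noiseSq_nonneg (g : ℝ → ℝ) (ω : Ω) : 0 ≤ noiseSq D ξ g ω :=
  tsum_nonneg fun _ => by positivity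

/-- The detour through `ℝ≥0∞` avoids any summability requirement: there a `tsum` of measurable
functions is always measurable. -/
lemma measurable_noiseSq (g : ℝ → ℝ) : Measurable (noiseSq D ξ g) := by
  have h : noiseSq D ξ g = fun ω => (∑' k, ENNReal.ofReal
      (g (D.eig k) ^ 2 * (ξ (T (D.basis k)) : Ω → ℝ) ω ^ 2)).toReal := by
    funext ω
    rw [ENNReal.tsum_toReal_eq fun _ => ENNReal.ofReal_ne_top]
    refine tsum_congr fun k => ?_
    rw [ENNReal.toReal_ofReal (by positivity)]
  rw [h]
  have hm : ∀ k, Measurable (ξ (T (D.basis k)) : Ω → ℝ) := fun k =>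
    (Lp.stronglyMeasurable _).measurable
  refine Measurable.ennreal_toReal (Measurable.tsum fun k => ?_)
  have := hm k
  fun_prop

variable {ξ}

lemma NoiseSummable.inner_filteredNoise {ω : Ω} (h : NoiseSummable D ξ g ω) (k : ℕ) :
    inner ℝ (D.basis k) (filteredNoise D ξ g ω)
      = g (D.eig k) * (ξ (T (D.basis k)) : Ω → ℝ) ω :=
  (exists_hasSum_of_summable_sq D.basis 
    (by simp only [mul_pow]; exact h)).2 k

lemma NoiseSummable.norm_filteredNoise_sq {ω : Ω} (h : NoiseSummable D ξ g ω) :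
    ‖filteredNoise D ξ g ω‖ ^ 2 = noiseSq D ξ g ω := by
  rw [← (hasSum_sq_inner_basis D.basis _).tsum_eq]
  refine tsum_congr fun k => ?_
  rw [h.inner_filteredNoise, mul_pow]

lemma NoiseSummable.sub {ω : Ω} (h₁ : NoiseSummable D ξ g₁ ω) (h₂ : NoiseSummable D ξ g₂ ω) :
    NoiseSummable D ξ (fun x => g₁ x - g₂ x) ω := by
  refine Summable.of_nonneg_of_le (fun k => by positivity) (fun k => ?_)
    ((h₁.mul_left 2).add (h₂.mul_left 2))
  have : 0 ≤ (g₁ (D.eig k) + g₂ (D.eig k)) ^ 2 * (ξ (T (D.basis k)) : Ω → ℝ) ω ^ 2 := by positivity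
  nlinarith

lemma NoiseSummable.noiseDist_eq {ω : Ω} (h₁ : NoiseSummable D ξ g₁ ω)
    (h₂ : NoiseSummable D ξ g₂ ω) :
    noiseDist D ξ g₁ g₂ ω = √(noiseSq D ξ (fun x => g₁ x - g₂ x) ω) := by
  have he : filteredNoise D ξ g₁ ω - filteredNoise D ξ g₂ ω
      = filteredNoise D ξ (fun x => g₁ x - g₂ x) ω := by
    refine hilbertBasis_ext D.basis fun k => ?_
    rw [inner_sub_right, h₁.inner_filteredNoise, h₂.inner_filteredNoise,
      (h₁.sub h₂).inner_filteredNoise]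
    ring
  rw [← (h₁.sub h₂).norm_filteredNoise_sq, ← he, Real.sqrt_sq (norm_nonneg _)]
  rfl

/-- Bias and noise separate in each coefficient, since the datum along `T e_k` is `λ_k ⟪e_k, f⟫ + σ
ξ(T e_k)`. Most of the work is square summability of the estimator's coefficients. -/
lemma NoiseSummable.estimator_sub (hg : IsSpectralFilter D g) {ω : Ω}
    (h : NoiseSummable D ξ g ω) (σ : ℝ) (f : X) :
    estimator D ξ σ f g ω - f = -residual D g f + σ • filteredNoise D ξ g ω := by
  have hs : Summable fun k =>
      (g (D.eig k) * observation T ξ σ f (T (D.basis k)) ω) ^ 2 := by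
    refine Summable.of_nonneg_of_le (fun k => by positivity) (fun k => ?_)
      (((hasSum_sq_inner_basis D.basis f).summable.mul_left 2).add (h.mul_left (2 * σ ^ 2)))
    rw [observation, D.inner_apply_basis]
    have h1 := hg.mul_le_one k
    have h2 := mul_nonneg (D.eig_nonneg k) (hg.nonneg k)
    have h3 : (D.eig k * g (D.eig k)) ^ 2 ≤ 1 := by nlinarith
    have h4 : ((D.eig k * g (D.eig k)) * inner ℝ (D.basis k) f) ^ 2
        ≤ (inner ℝ (D.basis k) f : ℝ) ^ 2 := by
      rw [mul_pow]; exact mul_le_of_le_one_left (sq_nonneg _) h3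
    have h5 := sq_nonneg ((D.eig k * g (D.eig k)) * inner ℝ (D.basis k) f
      - g (D.eig k) * (σ * (ξ (T (D.basis k)) : Ω → ℝ) ω))
    nlinarith
  refine hilbertBasis_ext D.basis fun k => ?_
  have he : inner ℝ (D.basis k) (estimator D ξ σ f g ω)
      = g (D.eig k) * observation T ξ σ f (T (D.basis k)) ω :=
    (exists_hasSum_of_summable_sq D.basis hs).2 k
  rw [inner_sub_right, he, inner_add_right, inner_neg_right, real_inner_smul_right,
    hg.inner_residual, h.inner_filteredNoise, observation, D.inner_apply_basis]
  ring

lemma NoiseSummable.norm_estimator_sub_le (hg : IsSpectralFilter D g) {ω : Ω}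
    (h : NoiseSummable D ξ g ω) {σ : ℝ} (hσ : 0 ≤ σ) (f : X) :
    ‖estimator D ξ σ f g ω - f‖ ≤ ‖residual D g f‖ + σ * √(noiseSq D ξ g ω) := by
  rw [h.estimator_sub hg, ← h.norm_filteredNoise_sq, Real.sqrt_sq (norm_nonneg _)]
  refine (norm_add_le _ _).trans_eq ?_
  rw [norm_neg, norm_smul, Real.norm_of_nonneg hσ]

lemma NoiseSummable.norm_estimator_sub_estimator_le (hg₁ : IsSpectralFilter D g₁)
    (hg₂ : IsSpectralFilter D g₂) (hle : ∀ k, g₁ (D.eig k) ≤ g₂ (D.eig k)) {ω : Ω}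
    (h₁ : NoiseSummable D ξ g₁ ω) (h₂ : NoiseSummable D ξ g₂ ω) {σ : ℝ} (hσ : 0 ≤ σ) (f : X) :
    ‖estimator D ξ σ f g₁ ω - estimator D ξ σ f g₂ ω‖
      ≤ ‖residual D g₁ f‖ + σ * noiseDist D ξ g₁ g₂ ω := by
  have he : estimator D ξ σ f g₁ ω - estimator D ξ σ f g₂ ω
      = -(residual D g₁ f - residual D g₂ f)
        + σ • (filteredNoise D ξ g₁ ω - filteredNoise D ξ g₂ ω) := by
    rw [← sub_sub_sub_cancel_right _ _ f, h₁.estimator_sub hg₁, h₂.estimator_sub hg₂, smul_sub]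
    abel
  rw [he]
  refine (norm_add_le _ _).trans (add_le_add ?_ ?_)
  · rw [norm_neg]; exact hg₁.norm_residual_sub_le hg₂ hle f
  · rw [norm_smul, Real.norm_of_nonneg hσ]; rfl

section Moments

variable [IsProbabilityMeasure P]

lemma IsWhiteNoise.summable_and_lintegral_exp_le (hξ : IsWhiteNoise P ξ)
    (hg : Summable fun k => D.eig k * g (D.eig k) ^ 2) {t : ℝ} (ht : 0 < t)
    (htg : ∀ k, t * (D.eig k * g (D.eig k) ^ 2) ≤ 1 / 4) :
    (∀ᵐ ω ∂P, NoiseSummable D ξ g ω) ∧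
    ∫⁻ ω, ENNReal.ofReal (Real.exp (t * noiseSq D ξ g ω)) ∂P
      ≤ ENNReal.ofReal (Real.exp (2 * t * varSum D.eig g)) := by
  have hl : ∀ k, ((‖T (D.basis k)‖₊ ^ 2 : ℝ≥0) : ℝ) = D.eig k := fun k => by
    rw [NNReal.coe_pow, coe_nnnorm, D.norm_apply_basis_sq]
  have hc : ∀ k, g (D.eig k) ^ 2 * ((‖T (D.basis k)‖₊ ^ 2 : ℝ≥0) : ℝ)
      = D.eig k * g (D.eig k) ^ 2 := fun k => by rw [hl, mul_comm]
  have h := Solit.summable_and_lintegral_exp_le (P := P)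
    (G := fun k => (ξ (T (D.basis k)) : Ω → ℝ))
    (lam := fun k => ‖T (D.basis k)‖₊ ^ 2) (w := fun k => g (D.eig k) ^ 2) (t := t)
    (fun k => (Lp.stronglyMeasurable _).measurable) (fun k => hξ _)
    (fun n => hξ.iIndepFun fun i j hij => D.pairwise_inner_apply_basis
      fun h => hij (Fin.ext h)) (fun k => sq_nonneg _)
    (by simpa only [hc] using hg) ht (by simpa only [hc] using htg)
  simp only [hc] at h
  exact h

lemma eig_mul_sq_le_varSum (hg : Summable fun k => D.eig k * g (D.eig k) ^ 2) (k : ℕ) :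
    D.eig k * g (D.eig k) ^ 2 ≤ varSum D.eig g :=
  hg.le_tsum k fun j _ => mul_nonneg (D.eig_nonneg j) (sq_nonneg _)

lemma varSum_nonneg (g : ℝ → ℝ) : 0 ≤ varSum D.eig g :=
  tsum_nonneg fun k => mul_nonneg (D.eig_nonneg k) (sq_nonneg _)

lemma IsWhiteNoise.ae_noiseSummable (hξ : IsWhiteNoise P ξ)
    (hg : Summable fun k => D.eig k * g (D.eig k) ^ 2) :
    ∀ᵐ ω ∂P, NoiseSummable D ξ g ω := by
  have hV := varSum_nonneg (D := D) g
  -- The `+ 1` keeps `t` positive and finite when the variance vanishes.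
  refine (hξ.summable_and_lintegral_exp_le hg (t := 1 / (4 * (varSum D.eig g + 1)))
    (by positivity) fun k => ?_).1
  have := eig_mul_sq_le_varSum hg k
  rw [div_mul_eq_mul_div, div_le_div_iff₀ (by positivity) (by norm_num)]
  linarith

lemma IsWhiteNoise.lintegral_noiseSq_sq_le (hξ : IsWhiteNoise P ξ)
    (hg : Summable fun k => D.eig k * g (D.eig k) ^ 2) (hV : 0 < varSum D.eig g) :
    ∫⁻ ω, ENNReal.ofReal (noiseSq D ξ g ω ^ 2) ∂P ≤ ENNReal.ofReal (64 * varSum D.eig g ^ 2) := by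
  -- Every weight is at most `V`, so this `t` is admissible. The moment bound becomes `32 V² exp
  -- (1/2)`, below `64 V²`.
  have h := (hξ.summable_and_lintegral_exp_le hg (t := 1 / (4 * varSum D.eig g))
    (by positivity) fun k => by
      have := eig_mul_sq_le_varSum hg k
      rw [div_mul_eq_mul_div, div_le_div_iff₀ (by positivity) (by norm_num)]
      linarith).2
  refine (lintegral_ofReal_sq_le_of_exp (noiseSq_nonneg ξ g) (by positivity) h).trans ?_
  refine ENNReal.ofReal_le_ofReal ?_
  have h1 : 2 * (1 / (4 * varSum D.eig g)) * varSum D.eig g = 1 / 2 := by field_simp; norm_num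
  have h2 : Real.exp (1 / 2) ≤ 2 := by
    have h3 := Real.exp_one_lt_d9
    have h4 : Real.exp (1 / 2) ^ 2 = Real.exp 1 := by rw [← Real.exp_nat_mul]; norm_num
    have h5 := Real.exp_pos (1 / 2)
    nlinarith
  rw [h1]
  have h6 : 2 / (1 / (4 * varSum D.eig g)) ^ 2 = 32 * varSum D.eig g ^ 2 := by field_simp; norm_num
  rw [h6]
  nlinarith [sq_nonneg (varSum D.eig g)]

/-- Integrate `x ≤ V + x²/V`, using the second moment; this gives `1 + 64`. -/
lemma IsWhiteNoise.lintegral_noiseSq_le (hξ : IsWhiteNoise P ξ)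
    (hg : Summable fun k => D.eig k * g (D.eig k) ^ 2) (hV : 0 < varSum D.eig g) :
    ∫⁻ ω, ENNReal.ofReal (noiseSq D ξ g ω) ∂P ≤ ENNReal.ofReal (65 * varSum D.eig g) := by
  set V := varSum D.eig g with hVdef
  have hpt : ∀ ω, ENNReal.ofReal (noiseSq D ξ g ω)
      ≤ ENNReal.ofReal V + ENNReal.ofReal V⁻¹ * ENNReal.ofReal (noiseSq D ξ g ω ^ 2) := by
    intro ω
    rw [← ENNReal.ofReal_mul (by positivity), ← ENNReal.ofReal_add hV.le (by positivity)]
    refine ENNReal.ofReal_le_ofReal ?_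
    have h1 : V + V⁻¹ * noiseSq D ξ g ω ^ 2 = (V ^ 2 + noiseSq D ξ g ω ^ 2) / V := by
      field_simp
    rw [h1, le_div_iff₀ hV]
    nlinarith [sq_nonneg (V - noiseSq D ξ g ω), sq_nonneg (V + noiseSq D ξ g ω)]
  refine (lintegral_mono hpt).trans ?_
  rw [lintegral_add_left measurable_const, lintegral_const, measure_univ, mul_one,
    lintegral_const_mul' _ _ ENNReal.ofReal_ne_top]
  calc ENNReal.ofReal V + ENNReal.ofReal V⁻¹ * ∫⁻ ω, ENNReal.ofReal (noiseSq D ξ g ω ^ 2) ∂P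
      ≤ ENNReal.ofReal V + ENNReal.ofReal V⁻¹ * ENNReal.ofReal (64 * V ^ 2) := by
        gcongr; exact hξ.lintegral_noiseSq_sq_le hg hV
    _ = ENNReal.ofReal (65 * V) := by
        rw [← ENNReal.ofReal_mul (by positivity), ← ENNReal.ofReal_add hV.le (by positivity)]
        congr 1; field_simp; norm_num

/-- Deviation inequality for the norm of the filtered noise. -/
lemma IsWhiteNoise.measure_noiseSq_le (hξ : IsWhiteNoise P ξ)
    (hg : Summable fun k => D.eig k * g (D.eig k) ^ 2) {M x : ℝ} (hM : 0 < M)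
    (hgM : ∀ k, D.eig k * g (D.eig k) ^ 2 ≤ M) :
    P {ω | 2 * varSum D.eig g + 4 * M * x < noiseSq D ξ g ω}
      ≤ ENNReal.ofReal (Real.exp (-x)) := by
  -- With `t = 1/(4M)` the level `x` is multiplied by the largest weight only, not by the total
  -- variance. The comparison of critical values with `√V` rests on this.
  have h := (hξ.summable_and_lintegral_exp_le hg (t := 1 / (4 * M)) (by positivity) fun k => by
      have := hgM k
      rw [div_mul_eq_mul_div, div_le_div_iff₀ (by positivity) (by norm_num)]
      linarith).2
  refine measure_lt_le_of_exp (measurable_noiseSq ξ g) (by positivity) h (le_of_eq ?_)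
  field_simp

end Moments

section CritValue

variable [IsProbabilityMeasure P]

lemma IsWhiteNoise.measure_noiseDist_le (hξ : IsWhiteNoise P ξ)
    (h₁ : Summable fun k => D.eig k * g₁ (D.eig k) ^ 2)
    (h₂ : Summable fun k => D.eig k * g₂ (D.eig k) ^ 2)
    (h : Summable fun k => D.eig k * (g₁ (D.eig k) - g₂ (D.eig k)) ^ 2) {M x : ℝ} (hM : 0 < M)
    (hx : 0 ≤ x) (hgM : ∀ k, D.eig k * (g₁ (D.eig k) - g₂ (D.eig k)) ^ 2 ≤ M) :
    P {ω | √(2 * varSum D.eig (fun x => g₁ x - g₂ x) + 4 * M * x) < noiseDist D ξ g₁ g₂ ω}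
      ≤ ENNReal.ofReal (Real.exp (-x)) := by
  refine le_trans (measure_mono_ae ?_) (
    hξ.measure_noiseSq_le (g := fun x => g₁ x - g₂ x) (x := x) h hM hgM)
  filter_upwards [hξ.ae_noiseSummable h₁, hξ.ae_noiseSummable h₂] with ω hω₁ hω₂ hω
  have hω' : √(2 * varSum D.eig (fun x => g₁ x - g₂ x) + 4 * M * x)
      < noiseDist D ξ g₁ g₂ ω := hω
  rw [hω₁.noiseDist_eq hω₂] at hω'
  exact (Real.sqrt_lt_sqrt_iff (by have := varSum_nonneg (D := D) (fun x => g₁ x - g₂ x); positivity)).1 hω'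

lemma IsWhiteNoise.critValue_le (hξ : IsWhiteNoise P ξ)
    (h₁ : Summable fun k => D.eig k * g₁ (D.eig k) ^ 2)
    (h₂ : Summable fun k => D.eig k * g₂ (D.eig k) ^ 2)
    (h : Summable fun k => D.eig k * (g₁ (D.eig k) - g₂ (D.eig k)) ^ 2) {M x : ℝ} (hM : 0 < M)
    (hx : 0 ≤ x) (hgM : ∀ k, D.eig k * (g₁ (D.eig k) - g₂ (D.eig k)) ^ 2 ≤ M) :
    critValue D ξ g₁ g₂ x
      ≤ √(2 * varSum D.eig (fun x => g₁ x - g₂ x) + 4 * M * x) :=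
  csInf_le ⟨0, fun _ hz => hz.1⟩
    ⟨Real.sqrt_nonneg _, hξ.measure_noiseDist_le h₁ h₂ h hM hx hgM⟩

/-- The infimum defining the quantile satisfies the tail bound itself: its exceedance event is the
increasing union of those at `z + 1/(n+1)`, and each of these levels lies above an admissible one.
No continuity of the law is needed. -/
lemma IsWhiteNoise.measure_critValue_lt (hξ : IsWhiteNoise P ξ)
    (h₁ : Summable fun k => D.eig k * g₁ (D.eig k) ^ 2)
    (h₂ : Summable fun k => D.eig k * g₂ (D.eig k) ^ 2)
    (h : Summable fun k => D.eig k * (g₁ (D.eig k) - g₂ (D.eig k)) ^ 2) {x : ℝ} (hx : 0 ≤ x) :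
    P {ω | critValue D ξ g₁ g₂ x < noiseDist D ξ g₁ g₂ ω} ≤ ENNReal.ofReal (Real.exp (-x)) := by
  set z := critValue D ξ g₁ g₂ x with hz
  have hV := varSum_nonneg (D := D) (fun x => g₁ x - g₂ x)
  have hne : {z : ℝ | 0 ≤ z ∧
      P {ω | z < noiseDist D ξ g₁ g₂ ω} ≤ ENNReal.ofReal (Real.exp (-x))}.Nonempty :=
    ⟨_, Real.sqrt_nonneg _, hξ.measure_noiseDist_le h₁ h₂ h
      (M := varSum D.eig (fun x => g₁ x - g₂ x) + 1) (by positivity) hx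
      fun k => (eig_mul_sq_le_varSum (g := fun x => g₁ x - g₂ x) h k).trans (by linarith)⟩
  have hU : {ω | z < noiseDist D ξ g₁ g₂ ω}
      = ⋃ n : ℕ, {ω | z + 1 / ((n : ℝ) + 1) < noiseDist D ξ g₁ g₂ ω} := by
    ext ω
    simp only [mem_ofPred_eq, mem_iUnion]
    constructor
    · intro hω
      obtain ⟨n, hn⟩ := exists_nat_one_div_lt (sub_pos.2 hω)
      exact ⟨n, by linarith⟩
    · rintro ⟨n, hn⟩
      have : (0 : ℝ) < 1 / ((n : ℝ) + 1) := by positivity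
      linarith
  rw [hU, Directed.measure_iUnion]
  · refine iSup_le fun n => ?_
    obtain ⟨y, ⟨hy0, hyP⟩, hy⟩ := exists_lt_of_csInf_lt hne
      (show critValue D ξ g₁ g₂ x < z + 1 / ((n : ℝ) + 1) by
        rw [← hz]; linarith [show (0 : ℝ) < 1 / ((n : ℝ) + 1) by positivity])
    refine (measure_mono fun ω hω => ?_).trans hyP
    exact hy.trans hω
  · refine directed_of_isDirected_le fun m n hmn ω hω => ?_
    have h1 : (1 : ℝ) / ((n : ℝ) + 1) ≤ 1 / ((m : ℝ) + 1) := by gcongr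
    have hω' : z + 1 / ((m : ℝ) + 1) < noiseDist D ξ g₁ g₂ ω := hω
    exact lt_of_le_of_lt (by linarith) hω'

end CritValue

end Noise

end Spectral

/-! ### Oracle inequality for geometric families of filters -/

section Oracle

variable {X Y : Type*}
  [NormedAddCommGroup X] [InnerProductSpace ℝ X] [CompleteSpace X]
  [NormedAddCommGroup Y] [InnerProductSpace ℝ Y] [CompleteSpace Y]
  {T : X →L[ℝ] Y} (D : EigenDecomposition T)

/-- The candidate filters are ordered and their variances grow geometrically. -/
structure IsGeometricFamily (q : ℝ → ℝ → ℝ) (α : ℕ → ℝ) (θ : ℝ) : Prop where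
  filter : ∀ m, IsSpectralFilter D (q (α m))
  mono : ∀ {m n}, m ≤ n → ∀ k, q (α m) (D.eig k) ≤ q (α n) (D.eig k)
  one_lt : 1 < θ
  pos : ∀ m, 0 < varSum D.eig (q (α m))
  growth : ∀ m, θ * varSum D.eig (q (α m)) ≤ varSum D.eig (q (α (m + 1)))

variable {D} {q : ℝ → ℝ → ℝ} {α : ℕ → ℝ} {θ : ℝ} {m n : ℕ}

namespace IsGeometricFamily

lemma varSum_mono (h : IsGeometricFamily D q α θ) :
    Monotone fun m => varSum D.eig (q (α m)) :=
  monotone_nat_of_le_succ fun m =>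
    (le_mul_of_one_le_left (h.pos m).le h.one_lt.le).trans (h.growth m)

lemma pow_mul_le (h : IsGeometricFamily D q α θ) (m : ℕ) :
    θ ^ m * varSum D.eig (q (α 0)) ≤ varSum D.eig (q (α m)) := by
  induction m with
  | zero => simp
  | succ m ih =>
    refine le_trans ?_ (h.growth m)
    rw [pow_succ', mul_assoc]
    exact mul_le_mul_of_nonneg_left ih (by linarith [h.one_lt])

lemma tendsto_varSum (h : IsGeometricFamily D q α θ) :
    Tendsto (fun m => varSum D.eig (q (α m))) atTop atTop :=
  tendsto_atTop_mono h.pow_mul_le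
    ((tendsto_pow_atTop_atTop_of_one_lt h.one_lt).atTop_mul_const (h.pos 0))

lemma sq_sub_le (h : IsGeometricFamily D q α θ) (hmn : m ≤ n) (k : ℕ) :
    D.eig k * (q (α m) (D.eig k) - q (α n) (D.eig k)) ^ 2
      ≤ D.eig k * q (α n) (D.eig k) ^ 2 := by
  refine mul_le_mul_of_nonneg_left ?_ (D.eig_nonneg k)
  have h1 := h.mono hmn k
  have h2 := (h.filter m).nonneg k
  nlinarith

lemma summable_sub (h : IsGeometricFamily D q α θ) (hmn : m ≤ n) :
    Summable fun k => D.eig k * (q (α m) (D.eig k) - q (α n) (D.eig k)) ^ 2 :=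
  Summable.of_nonneg_of_le (fun k => mul_nonneg (D.eig_nonneg k) (sq_nonneg _))
    (h.sq_sub_le hmn) (h.filter n).summable

lemma varSum_sub_le (h : IsGeometricFamily D q α θ) (hmn : m ≤ n) :
    varSum D.eig (fun x => q (α m) x - q (α n) x) ≤ varSum D.eig (q (α n)) :=
  (h.summable_sub hmn).tsum_le_tsum (h.sq_sub_le hmn) (h.filter n).summable

/-- The variance of a difference dominates the smaller variance. -/
lemma le_varSum_sub (h : IsGeometricFamily D q α θ) (hmn : m < n) :
    (θ - 1) ^ 2 / (2 * (θ + 1)) * varSum D.eig (q (α m))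
      ≤ varSum D.eig (fun x => q (α m) x - q (α n) x) := by
  have hθ := h.one_lt
  have h1 : varSum D.eig (q (α n)) ≤ (1 + (θ - 1) / 2) * varSum D.eig (q (α m))
      + (1 + 2 / (θ - 1)) * varSum D.eig (fun x => q (α m) x - q (α n) x) := by
    have hs1 := (h.filter m).summable.mul_left (1 + (θ - 1) / 2)
    have hs2 := (h.summable_sub hmn.le).mul_left (1 + 2 / (θ - 1))
    rw [varSum, varSum, varSum, ← tsum_mul_left, ← tsum_mul_left, ← hs1.tsum_add hs2]
    refine (h.filter n).summable.tsum_le_tsum (fun k => ?_) (hs1.add hs2)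
    have hk := D.eig_nonneg k
    set u := q (α m) (D.eig k)
    set v := q (α n) (D.eig k)
    -- Young's inequality with parameter `(θ - 1)/2`, small enough that the factor of `u²` stays
    -- below the growth factor `θ`.
    have key : v ^ 2 ≤ (1 + (θ - 1) / 2) * u ^ 2 + (1 + 2 / (θ - 1)) * (u - v) ^ 2 := by
      have hpos : 0 < θ - 1 := by linarith
      have e : (1 + (θ - 1) / 2) * u ^ 2 + (1 + 2 / (θ - 1)) * (u - v) ^ 2 - v ^ 2
          = ((θ - 1) * u + 2 * (u - v)) ^ 2 / (2 * (θ - 1)) := by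
        field_simp
        ring
      have : 0 ≤ ((θ - 1) * u + 2 * (u - v)) ^ 2 / (2 * (θ - 1)) := by positivity
      linarith
    calc D.eig k * v ^ 2 ≤ D.eig k * ((1 + (θ - 1) / 2) * u ^ 2
          + (1 + 2 / (θ - 1)) * (u - v) ^ 2) := mul_le_mul_of_nonneg_left key hk
      _ = _ := by ring
  have h2 : θ * varSum D.eig (q (α m)) ≤ varSum D.eig (q (α n)) :=
    (h.growth m).trans (h.varSum_mono hmn)
  have hpos : 0 < θ - 1 := by linarith
  have e2 : 1 + 2 / (θ - 1) = (θ + 1) / (θ - 1) := by field_simp; ring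
  rw [e2] at h1
  have h3 : (θ - 1) / 2 * varSum D.eig (q (α m))
      ≤ (θ + 1) / (θ - 1) * varSum D.eig (fun x => q (α m) x - q (α n) x) := by linarith
  have e3 : (θ - 1) ^ 2 / (2 * (θ + 1)) * varSum D.eig (q (α m))
      = (θ - 1) / (θ + 1) * ((θ - 1) / 2 * varSum D.eig (q (α m))) := by field_simp
  have e4 : varSum D.eig (fun x => q (α m) x - q (α n) x) = (θ - 1) / (θ + 1)
      * ((θ + 1) / (θ - 1) * varSum D.eig (fun x => q (α m) x - q (α n) x)) := by
    field_simp
  rw [e3, e4]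
  exact mul_le_mul_of_nonneg_left h3 (by positivity)

variable {σ : ℝ}

lemma one_le_mMax (h : IsGeometricFamily D q α θ) (hσ : 0 < σ) :
    1 ≤ σ ^ 2 * varSum D.eig (q (α (mMax D.eig q α σ))) := by
  have hne : {m : ℕ | 1 ≤ σ ^ 2 * varSum D.eig (q (α m))}.Nonempty :=
    ((h.tendsto_varSum.const_mul_atTop (by positivity : (0 : ℝ) < σ ^ 2)).eventually_ge_atTop
      1).exists
  exact Nat.sInf_mem hne

lemma lt_one_of_lt_mMax (hm : m < mMax D.eig q α σ) :
    σ ^ 2 * varSum D.eig (q (α m)) < 1 :=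
  not_le.1 fun hle => Nat.notMem_of_lt_sInf hm hle

variable {γ : ℝ}

/-- The noise level cancels, so rejection probabilities are powers of variance ratios. The index `m
+ 1` fits the candidate selected when `m` is the last one rejected. -/
lemma exp_neg_level (h : IsGeometricFamily D q α θ) (hσ : 0 < σ) (m : ℕ) :
    Real.exp (-level D.eig q α γ σ m)
      = (varSum D.eig (q (α (m + 1))) / varSum D.eig (q (α 0))) ^ (-(2 * (1 + γ))) := by
  rw [level, mul_div_mul_left _ _ (by positivity), Real.rpow_def_of_pos
    (div_pos (h.pos _) (h.pos _))]
  congr 1; ring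

lemma one_le_ratio (h : IsGeometricFamily D q α θ) (m : ℕ) :
    1 ≤ varSum D.eig (q (α m)) / varSum D.eig (q (α 0)) :=
  (one_le_div (h.pos 0)).2 (h.varSum_mono m.zero_le)

lemma level_nonneg (h : IsGeometricFamily D q α θ) (hσ : 0 < σ) (hγ : 0 < γ) (m : ℕ) :
    0 ≤ level D.eig q α γ σ m := by
  rw [level, mul_div_mul_left _ _ (by positivity)]
  exact mul_nonneg (by positivity) (Real.log_nonneg (h.one_le_ratio _))

/-- Allows the level of any `m < n` to be replaced by that of `n`, where `α n` is small. -/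
lemma level_mono (h : IsGeometricFamily D q α θ) (hσ : 0 < σ) (hγ : 0 < γ) :
    Monotone (level D.eig q α γ σ) := by
  intro m n hmn
  simp only [level]
  rw [mul_div_mul_left _ _ (by positivity), mul_div_mul_left _ _ (by positivity)]
  refine mul_le_mul_of_nonneg_left (Real.log_le_log (by linarith [h.one_le_ratio (m + 1)]) ?_)
    (by positivity)
  exact div_le_div_of_nonneg_right (h.varSum_mono (Nat.succ_le_succ hmn)) (h.pos 0).le

end IsGeometricFamily

section Noise

variable {Ω : Type*} [MeasurableSpace Ω] {P : Measure Ω}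

/-- Cauchy–Schwarz in additive form: on `E`, `sN ≤ sV/(2p) + (sp/(2V)) N²`. The first summand uses
`P E ≤ p²`, the constant `cV` uses `P E ≤ p`, and the second moment contributes `32 sVp`. -/
lemma lintegral_indicator_add_le {E : Set Ω} {N : Ω → ℝ} (hNm : Measurable N) {c V p s : ℝ}
    (hc : 0 ≤ c) (hV : 0 < V) (hp : 0 < p) (hs : 0 ≤ s)
    (hE : P E ≤ ENNReal.ofReal p) (hE2 : P E ≤ ENNReal.ofReal (p ^ 2))
    (hN : ∫⁻ ω, ENNReal.ofReal (N ω ^ 2) ∂P ≤ ENNReal.ofReal (64 * V ^ 2)) :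
    ∫⁻ ω, E.indicator (fun ω => ENNReal.ofReal (c * V + s * N ω)) ω ∂P
      ≤ ENNReal.ofReal ((c + 33 * s) * V * p) := by
  have hpt : ∀ ω, E.indicator (fun ω => ENNReal.ofReal (c * V + s * N ω)) ω
      ≤ E.indicator (fun _ => ENNReal.ofReal (c * V) + ENNReal.ofReal (s * V / (2 * p))) ω
        + ENNReal.ofReal (s * p / (2 * V)) * ENNReal.ofReal (N ω ^ 2) := by
    intro ω
    by_cases hω : ω ∈ E
    · rw [indicator_of_mem hω, indicator_of_mem hω, ← ENNReal.ofReal_mul (by positivity),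
        ← ENNReal.ofReal_add (by positivity) (by positivity),
        ← ENNReal.ofReal_add (by positivity) (by positivity), add_assoc]
      refine ENNReal.ofReal_le_ofReal (add_le_add le_rfl ?_)
      have e : s * V / (2 * p) + s * p / (2 * V) * N ω ^ 2 - s * N ω
          = s * (V - p * N ω) ^ 2 / (2 * p * V) := by field_simp; ring
      have : 0 ≤ s * (V - p * N ω) ^ 2 / (2 * p * V) := by positivity
      linarith
    · rw [indicator_of_notMem hω]; exact zero_le
  refine (lintegral_mono hpt).trans ?_
  rw [lintegral_add_right _ (by fun_prop), lintegral_const_mul' _ _ ENNReal.ofReal_ne_top]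
  calc ∫⁻ ω, E.indicator (fun _ => ENNReal.ofReal (c * V) + ENNReal.ofReal (s * V / (2 * p))) ω ∂P
        + ENNReal.ofReal (s * p / (2 * V)) * ∫⁻ ω, ENNReal.ofReal (N ω ^ 2) ∂P
      ≤ (ENNReal.ofReal (c * V) * P E + ENNReal.ofReal (s * V / (2 * p)) * P E)
        + ENNReal.ofReal (s * p / (2 * V)) * ∫⁻ ω, ENNReal.ofReal (N ω ^ 2) ∂P := by
        rw [← add_mul]
        gcongr
        exact lintegral_indicator_const_le _ _
    _ ≤ (ENNReal.ofReal (c * V) * ENNReal.ofReal p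
          + ENNReal.ofReal (s * V / (2 * p)) * ENNReal.ofReal (p ^ 2))
        + ENNReal.ofReal (s * p / (2 * V)) * ENNReal.ofReal (64 * V ^ 2) := by gcongr
    _ = ENNReal.ofReal (c * V * p + s * V / (2 * p) * p ^ 2 + s * p / (2 * V) * (64 * V ^ 2)) := by
        rw [← ENNReal.ofReal_mul (by positivity), ← ENNReal.ofReal_mul (by positivity),
          ← ENNReal.ofReal_mul (by positivity), ← ENNReal.ofReal_add (by positivity) (by positivity),
          ← ENNReal.ofReal_add (by positivity) (by positivity)]
    _ ≤ _ := by
        refine ENNReal.ofReal_le_ofReal ?_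
        have e : c * V * p + s * V / (2 * p) * p ^ 2 + s * p / (2 * V) * (64 * V ^ 2)
            = (c + 32.5 * s) * V * p := by field_simp; norm_num; ring
        rw [e]
        have : 0 ≤ s * V * p := by positivity
        nlinarith

variable {ξ : Y →ₗ[ℝ] Lp ℝ 2 P} {β γ σ : ℝ}

variable (D ξ q α) in
/-- The event that candidate `j` is rejected by the noise alone. -/
def falseRejection (γ σ : ℝ) (j : ℕ) : Set Ω :=
  {ω | ∃ m ∈ Finset.Ioc j (mMax D.eig q α σ),
    critValue D ξ (q (α j)) (q (α m)) (level D.eig q α γ σ j)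
      < noiseDist D ξ (q (α j)) (q (α m)) ω}

lemma IsGeometricFamily.measure_falseRejection_le [IsProbabilityMeasure P]
    (h : IsGeometricFamily D q α θ) (hξ : IsWhiteNoise P ξ) (hσ : 0 < σ) (hγ : 0 < γ) (j : ℕ) :
    P (falseRejection D q α ξ γ σ j) ≤ ENNReal.ofReal (mMax D.eig q α σ
      * (varSum D.eig (q (α (j + 1))) / varSum D.eig (q (α 0))) ^ (-(2 * (1 + γ)))) := by
  have hsub : falseRejection D q α ξ γ σ j ⊆ ⋃ m ∈ Finset.Ioc j (mMax D.eig q α σ),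
      {ω | critValue D ξ (q (α j)) (q (α m)) (level D.eig q α γ σ j)
        < noiseDist D ξ (q (α j)) (q (α m)) ω} := by
    rintro ω ⟨m, hm, hω⟩
    exact mem_biUnion (Finset.mem_coe.2 hm) hω
  refine (measure_mono hsub).trans ((measure_biUnion_finset_le _ _).trans ?_)
  have hterm : ∀ m ∈ Finset.Ioc j (mMax D.eig q α σ),
      P {ω | critValue D ξ (q (α j)) (q (α m)) (level D.eig q α γ σ j)
        < noiseDist D ξ (q (α j)) (q (α m)) ω}
      ≤ ENNReal.ofReal ((varSum D.eig (q (α (j + 1))) / varSum D.eig (q (α 0)))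
        ^ (-(2 * (1 + γ)))) := by
    intro m hm
    rw [← h.exp_neg_level hσ]
    exact hξ.measure_critValue_lt (h.filter j).summable (h.filter m).summable
      (h.summable_sub (Finset.mem_Ioc.1 hm).1.le) (h.level_nonneg hσ hγ j)
  refine (Finset.sum_le_sum hterm).trans ?_
  rw [Finset.sum_const, nsmul_eq_mul, ENNReal.ofReal_mul (by positivity), ENNReal.ofReal_natCast]
  gcongr
  rw [Nat.card_Ioc]
  exact Nat.sub_le _ _

/-- If every candidate from `j` on has small bias, then rejecting `j` is a false rejection. -/
lemma IsGeometricFamily.mem_falseRejection (h : IsGeometricFamily D q α θ) (hσ : 0 < σ)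
    {ω : Ω} (hω : ∀ m, NoiseSummable D ξ (q (α m)) ω) {f : X} {j m₂ : ℕ} (hβ : 0 ≤ β)
    (hbias : ‖residual D (q (α j)) f‖
      ≤ β * √((θ - 1) ^ 2 / (2 * (θ + 1))) * √(σ ^ 2 * varSum D.eig (q (α j))))
    (hj : j < m₂) (hm₂ : m₂ ≤ mMax D.eig q α σ)
    (hrej : threshold D ξ q α β γ σ j m₂
      < ‖estimator D ξ σ f (q (α j)) ω - estimator D ξ σ f (q (α m₂)) ω‖) :
    ω ∈ falseRejection D q α ξ γ σ j := by
  refine ⟨m₂, Finset.mem_Ioc.2 ⟨hj, hm₂⟩, ?_⟩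
  have h1 := (hω j).norm_estimator_sub_estimator_le (h.filter j) (h.filter m₂) (h.mono hj.le)
    (hω m₂) hσ.le f
  have hθ := h.one_lt
  have h2 : β * √((θ - 1) ^ 2 / (2 * (θ + 1))) * √(σ ^ 2 * varSum D.eig (q (α j)))
      ≤ β * √(σ ^ 2 * varSum D.eig (fun x => q (α j) x - q (α m₂) x)) := by
    rw [mul_assoc, ← Real.sqrt_mul (by positivity)]
    refine mul_le_mul_of_nonneg_left (Real.sqrt_le_sqrt ?_) hβ
    have := mul_le_mul_of_nonneg_left (h.le_varSum_sub hj) (sq_nonneg σ)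
    linarith
  rw [threshold] at hrej
  have h3 : σ * critValue D ξ (q (α j)) (q (α m₂)) (level D.eig q α γ σ j)
      < σ * noiseDist D ξ (q (α j)) (q (α m₂)) ω := by linarith
  exact lt_of_mul_lt_mul_left h3 hσ.le

/-- Pathwise error bound for the SOLIT estimator. -/
lemma IsGeometricFamily.solitEstimator_error_le (h : IsGeometricFamily D q α θ) (hσ : 0 < σ)
    {ω : Ω} (hω : ∀ m, NoiseSummable D ξ (q (α m)) ω) {f : X} {n : ℕ} (hβ : 0 ≤ β) {K b : ℝ}
    (hK : 0 ≤ K) (hb : b = β * √((θ - 1) ^ 2 / (2 * (θ + 1))))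
    (hn : n ≤ mMax D.eig q α σ)
    (hbias : ‖residual D (q (α n)) f‖ ≤ b * √(σ ^ 2 * varSum D.eig (q (α n))))
    (hcrit : ∀ m < n, critValue D ξ (q (α m)) (q (α n)) (level D.eig q α γ σ m)
      ≤ K * √(varSum D.eig (q (α n)))) :
    ‖solitEstimator D ξ q α β γ σ f ω - f‖ₑ ^ 2
      ≤ ENNReal.ofReal (2 * (K + β + b) ^ 2 * (σ ^ 2 * varSum D.eig (q (α n)))
          + 2 * σ ^ 2 * noiseSq D ξ (q (α n)) ω)
        + ∑ j ∈ Finset.Ico n (mMax D.eig q α σ),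
          (falseRejection D q α ξ γ σ j).indicator (fun ω => ENNReal.ofReal
            (2 * b ^ 2 * σ ^ 2 * varSum D.eig (q (α (j + 1)))
              + 2 * σ ^ 2 * noiseSq D ξ (q (α (j + 1))) ω)) ω := by
  have hb0 : 0 ≤ b := by rw [hb]; positivity
  have hsq : ∀ {x A B c : ℝ}, 0 ≤ x → 0 ≤ B → x ≤ A * √(σ ^ 2 * B) + σ * √c → 0 ≤ c →
      x ^ 2 ≤ 2 * A ^ 2 * (σ ^ 2 * B) + 2 * σ ^ 2 * c := by
    intro x A B c hx hB hle hc
    have h1 : √(σ ^ 2 * B) ^ 2 = σ ^ 2 * B := Real.sq_sqrt (by positivity)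
    have h2 : √c ^ 2 = c := Real.sq_sqrt hc
    have h3 : x ^ 2 ≤ (A * √(σ ^ 2 * B) + σ * √c) ^ 2 := pow_le_pow_left₀ hx hle 2
    have h4 := sq_nonneg (A * √(σ ^ 2 * B) - σ * √c)
    calc x ^ 2 ≤ 2 * A ^ 2 * √(σ ^ 2 * B) ^ 2 + 2 * σ ^ 2 * √c ^ 2 := by nlinarith
      _ = _ := by rw [h1, h2]
  have hnorm : ∀ z : X, ‖z‖ₑ ^ 2 = ENNReal.ofReal (‖z‖ ^ 2) := fun z => by
    rw [← ofReal_norm, ENNReal.ofReal_pow (norm_nonneg _)]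
  have hVn := (h.pos n).le
  rw [hnorm]
  set S := {m₁ : ℕ | m₁ ≤ mMax D.eig q α σ ∧ ∀ m₂, m₁ < m₂ → m₂ ≤ mMax D.eig q α σ →
    ‖estimator D ξ σ f (q (α m₁)) ω - estimator D ξ σ f (q (α m₂)) ω‖
      - threshold D ξ q α β γ σ m₁ m₂ ≤ 0} with hS
  -- The last candidate has no competitor and is accepted vacuously.
  have hne : S.Nonempty := ⟨mMax D.eig q α σ, le_rfl, fun m₂ h1 h2 => absurd h2 (not_le.2 h1)⟩
  have hmem : solitIndex D ξ q α β γ σ f ω ∈ S := Nat.sInf_mem hne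
  have hmin : ∀ m, m < solitIndex D ξ q α β γ σ f ω → m ∉ S := fun m hm =>
    Nat.notMem_of_lt_sInf hm
  rw [solitEstimator]
  set M := solitIndex D ξ q α β γ σ f ω with hM
  rcases le_or_gt M n with hMn | hMn
  -- Early stop: the selected candidate passed its comparison with `n`, so it lies within the
  -- threshold of the oracle estimator.
  · refine le_add_right (ENNReal.ofReal_le_ofReal (hsq (norm_nonneg _) hVn ?_
      (noiseSq_nonneg ξ _ ω)))
    have h1 := (hω n).norm_estimator_sub_le (h.filter n) hσ.le f
    have h2 : ‖estimator D ξ σ f (q (α M)) ω - estimator D ξ σ f (q (α n)) ω‖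
        ≤ (K + β) * √(σ ^ 2 * varSum D.eig (q (α n))) := by
      rcases hMn.eq_or_lt with rfl | hlt
      · rw [sub_self, norm_zero]; positivity
      · have h3 := hmem.2 n hlt hn
        rw [threshold] at h3
        have h4 : σ * critValue D ξ (q (α M)) (q (α n)) (level D.eig q α γ σ M)
            ≤ K * √(σ ^ 2 * varSum D.eig (q (α n))) := by
          rw [Real.sqrt_mul (sq_nonneg σ), Real.sqrt_sq hσ.le]
          have := mul_le_mul_of_nonneg_left (hcrit M hlt) hσ.le
          linarith
        have h5 : β * √(σ ^ 2 * varSum D.eig (fun x => q (α M) x - q (α n) x))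
            ≤ β * √(σ ^ 2 * varSum D.eig (q (α n))) := by
          refine mul_le_mul_of_nonneg_left (Real.sqrt_le_sqrt ?_) hβ
          exact mul_le_mul_of_nonneg_left (h.varSum_sub_le hlt.le) (sq_nonneg σ)
        linarith
    have h6 := norm_sub_le_norm_sub_add_norm_sub (estimator D ξ σ f (q (α M)) ω)
      (estimator D ξ σ f (q (α n)) ω) f
    linarith
  -- Late stop: by minimality the index just before the selected one was rejected. Its bias is still
  -- small, since beyond `n` bias falls and variance rises.
  · obtain ⟨j, hj⟩ : ∃ j, M = j + 1 := ⟨M - 1, by omega⟩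
    have hbias' : ∀ m, n ≤ m → ‖residual D (q (α m)) f‖
        ≤ b * √(σ ^ 2 * varSum D.eig (q (α m))) := by
      intro m hm
      refine ((h.filter n).norm_residual_le (h.filter m) (h.mono hm) f).trans (hbias.trans ?_)
      refine mul_le_mul_of_nonneg_left (Real.sqrt_le_sqrt ?_) hb0
      exact mul_le_mul_of_nonneg_left (h.varSum_mono hm) (sq_nonneg σ)
    have hjmem : j ∈ Finset.Ico n (mMax D.eig q α σ) := by
      have := hmem.1
      rw [Finset.mem_Ico]; omega
    have hrej : ω ∈ falseRejection D q α ξ γ σ j := by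
      have hjS := hmin j (by omega)
      rw [hS] at hjS
      have hjle : j ≤ mMax D.eig q α σ := (Finset.mem_Ico.1 hjmem).2.le
      have : ¬ ∀ m₂, j < m₂ → m₂ ≤ mMax D.eig q α σ →
        ‖estimator D ξ σ f (q (α j)) ω - estimator D ξ σ f (q (α m₂)) ω‖
          - threshold D ξ q α β γ σ j m₂ ≤ 0 := fun hall => hjS ⟨hjle, hall⟩
      push Not at this
      obtain ⟨m₂, hm1, hm2, hm3⟩ := this
      refine h.mem_falseRejection hσ hω hβ ?_ hm1 hm2 (sub_pos.1 hm3)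
      rw [← hb]
      exact hbias' j (Finset.mem_Ico.1 hjmem).1
    refine le_add_left (le_trans ?_ (Finset.single_le_sum_of_canonicallyOrdered hjmem))
    rw [indicator_of_mem hrej, hj]
    refine ENNReal.ofReal_le_ofReal ?_
    have h1 := (hω (j + 1)).norm_estimator_sub_le (h.filter (j + 1)) hσ.le f
    have h2 := hsq (x := ‖estimator D ξ σ f (q (α (j + 1))) ω - f‖) (A := b) (norm_nonneg _)
      (h.pos (j + 1)).le (h1.trans (add_le_add (hbias' (j + 1) (by omega)) le_rfl))
      (noiseSq_nonneg ξ _ ω)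
    linarith

/-- Oracle inequality for the SOLIT estimator. -/
theorem IsGeometricFamily.solitMSE_le [IsProbabilityMeasure P] (h : IsGeometricFamily D q α θ)
    (hξ : IsWhiteNoise P ξ) (hσ : 0 < σ) {f : X} {n : ℕ} (hβ : 0 ≤ β) (hγ : 0 < γ) {K b : ℝ}
    (hK : 0 ≤ K) (hb : b = β * √((θ - 1) ^ 2 / (2 * (θ + 1))))
    (hn : n ≤ mMax D.eig q α σ) (hmax : 1 ≤ mMax D.eig q α σ)
    (hbias : ‖residual D (q (α n)) f‖ ≤ b * √(σ ^ 2 * varSum D.eig (q (α n))))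
    (hcrit : ∀ m < n, critValue D ξ (q (α m)) (q (α n)) (level D.eig q α γ σ m)
      ≤ K * √(varSum D.eig (q (α n)))) :
    solitMSE D ξ q α β γ σ f ≤ ENNReal.ofReal
      ((2 * (K + β + b) ^ 2 + 130) * (σ ^ 2 * varSum D.eig (q (α n)))
        + (2 * b ^ 2 + 66) * varSum D.eig (q (α 0)) / (1 - θ ^ (-γ))
          * (σ ^ 2 * mMax D.eig q α σ)) := by
  set V := fun m => varSum D.eig (q (α m)) with hV
  set N := mMax D.eig q α σ with hN
  have hVpos : ∀ m, 0 < V m := h.pos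
  have hb0 : 0 ≤ b := by rw [hb]; positivity
  -- Half the exponent of the rejection probability, which is then at most `p j`, and also at most
  -- `p j ^ 2` because `N ≥ 1`.
  set p : ℕ → ℝ := fun j => N * (V (j + 1) / V 0) ^ (-(1 + γ)) with hp
  have hN1 : (1 : ℝ) ≤ N := by exact_mod_cast hmax
  have hr : ∀ j, 1 ≤ V j / V 0 := h.one_le_ratio
  have hppos : ∀ j, 0 < p j := fun j => by
    have := hr (j + 1)
    positivity
  have hE := h.measure_falseRejection_le hξ hσ hγ
  have hEp : ∀ j, P (falseRejection D q α ξ γ σ j) ≤ ENNReal.ofReal (p j) := fun j => by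
    refine (hE j).trans (ENNReal.ofReal_le_ofReal ?_)
    refine mul_le_mul_of_nonneg_left ?_ (by positivity)
    exact Real.rpow_le_rpow_of_exponent_le (hr _) (by linarith)
  have hEp2 : ∀ j, P (falseRejection D q α ξ γ σ j) ≤ ENNReal.ofReal (p j ^ 2) := fun j => by
    refine (hE j).trans (ENNReal.ofReal_le_ofReal ?_)
    have hrj : 0 < V (j + 1) / V 0 := by linarith [hr (j + 1)]
    have e : p j ^ 2 = N * (N * (V (j + 1) / V 0) ^ (-(2 * (1 + γ)))) := by
      rw [hp, mul_pow, ← Real.rpow_natCast ((V (j + 1) / V 0) ^ (-(1 + γ))) 2,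
        ← Real.rpow_mul hrj.le]
      rw [show -(1 + γ) * ((2 : ℕ) : ℝ) = -(2 * (1 + γ)) by push_cast; ring]
      ring
    rw [e]
    exact le_mul_of_one_le_left (by positivity) hN1
  -- Measurable hulls replace the rejection events, so measurability of critical exceedances is
  -- never needed.
  set E : ℕ → Set Ω := fun j => toMeasurable P (falseRejection D q α ξ γ σ j) with hEdef
  have hterm : ∀ j, ∫⁻ ω, (E j).indicator (fun ω => ENNReal.ofReal
      (2 * b ^ 2 * σ ^ 2 * V (j + 1) + 2 * σ ^ 2 * noiseSq D ξ (q (α (j + 1))) ω)) ω ∂P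
      ≤ ENNReal.ofReal ((2 * b ^ 2 * σ ^ 2 + 33 * (2 * σ ^ 2)) * V (j + 1) * p j) := fun j =>
    lintegral_indicator_add_le (measurable_noiseSq ξ _) (by positivity)
      (hVpos _) (hppos j) (by positivity) (by rw [hEdef, measure_toMeasurable]; exact hEp j)
      (by rw [hEdef, measure_toMeasurable]; exact hEp2 j)
      (hξ.lintegral_noiseSq_sq_le (h.filter _).summable (hVpos _))
  have hfirst : ∫⁻ ω, ENNReal.ofReal (2 * (K + β + b) ^ 2 * (σ ^ 2 * V n)
      + 2 * σ ^ 2 * noiseSq D ξ (q (α n)) ω) ∂P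
      ≤ ENNReal.ofReal ((2 * (K + β + b) ^ 2 + 130) * (σ ^ 2 * V n)) := by
    have hVn := hVpos n
    have e : ∀ ω, ENNReal.ofReal (2 * (K + β + b) ^ 2 * (σ ^ 2 * V n)
        + 2 * σ ^ 2 * noiseSq D ξ (q (α n)) ω)
        = ENNReal.ofReal (2 * (K + β + b) ^ 2 * (σ ^ 2 * V n))
          + ENNReal.ofReal (2 * σ ^ 2) * ENNReal.ofReal (noiseSq D ξ (q (α n)) ω) := fun ω => by
      rw [ENNReal.ofReal_add (by positivity)
        (mul_nonneg (by positivity) (noiseSq_nonneg ξ _ ω)), ENNReal.ofReal_mul (by positivity)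
        (q := noiseSq D ξ (q (α n)) ω)]
    rw [lintegral_congr e, lintegral_add_left measurable_const, lintegral_const, measure_univ,
      mul_one, lintegral_const_mul' _ _ ENNReal.ofReal_ne_top]
    calc _ ≤ ENNReal.ofReal (2 * (K + β + b) ^ 2 * (σ ^ 2 * V n))
          + ENNReal.ofReal (2 * σ ^ 2) * ENNReal.ofReal (65 * V n) := by
          gcongr
          exact hξ.lintegral_noiseSq_le (h.filter n).summable hVn
      _ = _ := by
          rw [← ENNReal.ofReal_mul (by positivity), ← ENNReal.ofReal_add (by positivity)
            (by positivity)]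
          congr 1; ring
  have hpath : ∀ᵐ ω ∂P, ‖solitEstimator D ξ q α β γ σ f ω - f‖ₑ ^ 2
      ≤ ENNReal.ofReal (2 * (K + β + b) ^ 2 * (σ ^ 2 * V n)
          + 2 * σ ^ 2 * noiseSq D ξ (q (α n)) ω)
        + ∑ j ∈ Finset.Ico n N, (E j).indicator (fun ω => ENNReal.ofReal
            (2 * b ^ 2 * σ ^ 2 * V (j + 1)
              + 2 * σ ^ 2 * noiseSq D ξ (q (α (j + 1))) ω)) ω := by
    have hall : ∀ᵐ ω ∂P, ∀ m, NoiseSummable D ξ (q (α m)) ω :=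
      ae_all_iff.2 fun m => hξ.ae_noiseSummable (h.filter m).summable
    filter_upwards [hall] with ω hω
    refine (h.solitEstimator_error_le hσ hω hβ hK hb hn hbias hcrit).trans ?_
    refine add_le_add le_rfl (Finset.sum_le_sum fun j _ => ?_)
    exact indicator_le_indicator_of_subset (subset_toMeasurable _ _) (fun _ => zero_le) ω
  have hθ := h.one_lt
  have hθγ : θ ^ (-γ) < 1 := Real.rpow_lt_one_of_one_lt_of_neg hθ (by linarith)
  have hθγ0 : 0 < θ ^ (-γ) := Real.rpow_pos_of_pos (by linarith) _
  -- One power of the variance ratio pays for the size of the error; the surplus `γ` leaves a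
  -- geometric series.
  have hVp : ∀ j, V (j + 1) * p j ≤ V 0 * N * (θ ^ (-γ)) ^ j := fun j => by
    have hrj : 0 < V (j + 1) / V 0 := by linarith [hr (j + 1)]
    have e1 : V (j + 1) * p j = V 0 * N * (V (j + 1) / V 0) ^ (-γ) := by
      have e2 : (V (j + 1) / V 0) * (V (j + 1) / V 0) ^ (-(1 + γ))
          = (V (j + 1) / V 0) ^ (-γ) := by
        nth_rewrite 1 [← Real.rpow_one (V (j + 1) / V 0)]
        rw [← Real.rpow_add hrj]
        congr 1; ring
      rw [← e2, hp]
      have := (hVpos 0).ne'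
      field_simp
    rw [e1]
    refine mul_le_mul_of_nonneg_left ?_ (mul_nonneg (hVpos 0).le (by positivity))
    rw [← Real.rpow_natCast, ← Real.rpow_mul (by linarith), mul_comm (-γ),
      Real.rpow_mul (by linarith), Real.rpow_natCast]
    refine Real.rpow_le_rpow_of_nonpos (by positivity) ?_ (by linarith)
    rw [le_div_iff₀ (hVpos 0)]
    exact (h.pow_mul_le j).trans (h.varSum_mono j.le_succ)
  calc solitMSE D ξ q α β γ σ f
      ≤ ∫⁻ ω, (ENNReal.ofReal (2 * (K + β + b) ^ 2 * (σ ^ 2 * V n)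
          + 2 * σ ^ 2 * noiseSq D ξ (q (α n)) ω)
        + ∑ j ∈ Finset.Ico n N, (E j).indicator (fun ω => ENNReal.ofReal
            (2 * b ^ 2 * σ ^ 2 * V (j + 1)
              + 2 * σ ^ 2 * noiseSq D ξ (q (α (j + 1))) ω)) ω) ∂P := lintegral_mono_ae hpath
    _ = ∫⁻ ω, ENNReal.ofReal (2 * (K + β + b) ^ 2 * (σ ^ 2 * V n)
          + 2 * σ ^ 2 * noiseSq D ξ (q (α n)) ω) ∂P
        + ∑ j ∈ Finset.Ico n N, ∫⁻ ω, (E j).indicator (fun ω => ENNReal.ofReal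
            (2 * b ^ 2 * σ ^ 2 * V (j + 1)
              + 2 * σ ^ 2 * noiseSq D ξ (q (α (j + 1))) ω)) ω ∂P := by
        rw [lintegral_add_left, lintegral_finsetSum]
        · intro j _
          refine Measurable.indicator ?_ (measurableSet_toMeasurable _ _)
          have := measurable_noiseSq (D := D) ξ (q (α (j + 1)))
          fun_prop
        · have := measurable_noiseSq (D := D) ξ (q (α n))
          fun_prop
    _ ≤ ENNReal.ofReal ((2 * (K + β + b) ^ 2 + 130) * (σ ^ 2 * V n))
        + ∑ j ∈ Finset.Ico n N,
          ENNReal.ofReal ((2 * b ^ 2 * σ ^ 2 + 33 * (2 * σ ^ 2)) * V (j + 1) * p j) :=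
        add_le_add hfirst (Finset.sum_le_sum fun j _ => hterm j)
    _ ≤ _ := by
        have hnn : ∀ j, 0 ≤ (2 * b ^ 2 * σ ^ 2 + 33 * (2 * σ ^ 2)) * V (j + 1) * p j := fun j => by
          have := hVpos (j + 1)
          have := hppos j
          positivity
        have hVn := hVpos n
        rw [← ENNReal.ofReal_sum_of_nonneg fun j _ => hnn j, ← ENNReal.ofReal_add (by positivity)
          (Finset.sum_nonneg fun j _ => hnn j)]
        refine ENNReal.ofReal_le_ofReal (add_le_add le_rfl ?_)
        have hgeom : ∑ j ∈ Finset.Ico n N, (θ ^ (-γ)) ^ j ≤ (1 - θ ^ (-γ))⁻¹ := by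
          rw [← tsum_geometric_of_lt_one hθγ0.le hθγ]
          exact (summable_geometric_of_lt_one hθγ0.le hθγ).sum_le_tsum _
            fun j _ => pow_nonneg hθγ0.le j
        have hV0 := hVpos 0
        calc ∑ j ∈ Finset.Ico n N, (2 * b ^ 2 * σ ^ 2 + 33 * (2 * σ ^ 2)) * V (j + 1) * p j
            ≤ ∑ j ∈ Finset.Ico n N, (2 * b ^ 2 * σ ^ 2 + 33 * (2 * σ ^ 2))
                * (V 0 * N * (θ ^ (-γ)) ^ j) := by
              refine Finset.sum_le_sum fun j _ => ?_
              rw [mul_assoc]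
              exact mul_le_mul_of_nonneg_left (hVp j) (by positivity)
          _ = (2 * b ^ 2 * σ ^ 2 + 33 * (2 * σ ^ 2)) * (V 0 * N)
                * ∑ j ∈ Finset.Ico n N, (θ ^ (-γ)) ^ j := by
              rw [Finset.mul_sum]
              exact Finset.sum_congr rfl fun j _ => by ring
          _ ≤ (2 * b ^ 2 * σ ^ 2 + 33 * (2 * σ ^ 2)) * (V 0 * N) * (1 - θ ^ (-γ))⁻¹ :=
              mul_le_mul_of_nonneg_left hgeom (by positivity)
          _ = _ := by ring

end Noise

end Oracle

/-! ### Stretched-exponential eigenvalues: variance and counting bounds -/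

section Analysis

/-- Powers are negligible against stretched exponentials. -/
lemma tendsto_rpow_mul_exp_neg_rpow (s : ℝ) {b θ : ℝ} (hb : 0 < b) (hθ : 0 < θ) :
    Tendsto (fun k : ℕ => ((k : ℝ) + 1) ^ s * Real.exp (-b * ((k : ℝ) + 1) ^ θ)) atTop (𝓝 0) := by
  have h1 : Tendsto (fun k : ℕ => ((k : ℝ) + 1) ^ θ) atTop atTop :=
    (tendsto_rpow_atTop hθ).comp (tendsto_atTop_add_const_right _ _ tendsto_natCast_atTop_atTop)
  refine ((tendsto_rpow_mul_exp_neg_mul_atTop_nhds_zero (s / θ) b hb).comp h1).congr fun k => ?_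
  simp only [Function.comp_apply]
  rw [← Real.rpow_mul (by positivity), mul_div_cancel₀ _ hθ.ne']

lemma exists_rpow_mul_exp_neg_rpow_le (s : ℝ) {b θ : ℝ} (hb : 0 < b) (hθ : 0 < θ) :
    ∃ C > 0, ∀ k : ℕ, ((k : ℝ) + 1) ^ s * Real.exp (-b * ((k : ℝ) + 1) ^ θ) ≤ C := by
  obtain ⟨C, hC⟩ := (tendsto_rpow_mul_exp_neg_rpow s hb hθ).bddAbove_range
  exact ⟨max C 1, by positivity, fun k => (hC (mem_range_self k)).trans (le_max_left _ _)⟩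

lemma summable_exp_neg_rpow {b θ : ℝ} (hb : 0 < b) (hθ : 0 < θ) :
    Summable fun k : ℕ => Real.exp (-b * ((k : ℝ) + 1) ^ θ) := by
  obtain ⟨C, -, hC⟩ := exists_rpow_mul_exp_neg_rpow_le 2 hb hθ
  have hs : Summable fun k : ℕ => C * (1 / ((k : ℝ) + 1) ^ 2) := by
    have := (summable_nat_add_iff 1).2 (Real.summable_one_div_nat_pow.2 (one_lt_two))
    refine Summable.mul_left C ?_
    simpa using this
  refine Summable.of_nonneg_of_le (fun _ => (Real.exp_pos _).le) (fun k => ?_) hs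
  have h1 := hC k
  rw [mul_one_div, le_div_iff₀ (by positivity), mul_comm]
  rw [show (2 : ℝ) = ((2 : ℕ) : ℝ) by norm_num, Real.rpow_natCast] at h1
  exact h1

variable {eig : ℕ → ℝ} {a b θ c : ℝ}

/-- Half of the exponent absorbs the polynomial factor. The loss in `b` is harmless, as it changes
only constants in the powers of logarithms used later. -/
lemma exists_le_exp_neg_rpow (hb : 0 < b) (hθ : 0 < θ) (hc : 0 < c)
    (h : ∀ k : ℕ, eig k ≤ c * ((k : ℝ) + 1) ^ (-a) * Real.exp (-b * ((k : ℝ) + 1) ^ θ)) :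
    ∃ C > 0, ∀ k : ℕ, eig k ≤ C * Real.exp (-(b / 2) * ((k : ℝ) + 1) ^ θ) := by
  obtain ⟨C, hC0, hC⟩ := exists_rpow_mul_exp_neg_rpow_le (-a) (half_pos hb) hθ
  refine ⟨c * C, by positivity, fun k => (h k).trans ?_⟩
  have e : Real.exp (-b * ((k : ℝ) + 1) ^ θ)
      = Real.exp (-(b / 2) * ((k : ℝ) + 1) ^ θ) * Real.exp (-(b / 2) * ((k : ℝ) + 1) ^ θ) := by
    rw [← Real.exp_add]; congr 1; ring
  rw [e, mul_assoc, mul_assoc, ← mul_assoc (((k : ℝ) + 1) ^ (-a))]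
  gcongr
  exact hC k

lemma exists_exp_neg_rpow_le (hb : 0 < b) (hθ : 0 < θ) (hc : 0 < c)
    (h : ∀ k : ℕ, c * ((k : ℝ) + 1) ^ (-a) * Real.exp (-b * ((k : ℝ) + 1) ^ θ) ≤ eig k) :
    ∃ C > 0, ∀ k : ℕ, C * Real.exp (-(2 * b) * ((k : ℝ) + 1) ^ θ) ≤ eig k := by
  obtain ⟨C, hC0, hC⟩ := exists_rpow_mul_exp_neg_rpow_le a hb hθ
  refine ⟨c / C, by positivity, fun k => le_trans ?_ (h k)⟩
  have e : Real.exp (-(2 * b) * ((k : ℝ) + 1) ^ θ)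
      = Real.exp (-b * ((k : ℝ) + 1) ^ θ) * Real.exp (-b * ((k : ℝ) + 1) ^ θ) := by
    rw [← Real.exp_add]; congr 1; ring
  have h1 : C⁻¹ * Real.exp (-b * ((k : ℝ) + 1) ^ θ) ≤ ((k : ℝ) + 1) ^ (-a) := by
    rw [Real.rpow_neg (by positivity), inv_mul_le_iff₀ hC0, ← div_eq_mul_inv,
      le_div_iff₀ (by positivity), mul_comm]
    exact hC k
  rw [e, div_eq_mul_inv, mul_assoc, ← mul_assoc C⁻¹, ← mul_assoc]
  exact mul_le_mul_of_nonneg_right (mul_le_mul_of_nonneg_left h1 hc.le) (Real.exp_pos _).le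

/-- Upper bound for the variance of a filter with `α q ≤ C`. -/
lemma exists_varSum_le (hb : 0 < b) (hθ : 0 < θ) (hpos : ∀ k, 0 ≤ eig k) {C B : ℝ} (hC : 0 < C)
    (h : ∀ k : ℕ, eig k ≤ C * Real.exp (-b * ((k : ℝ) + 1) ^ θ)) (hB : 0 < B) :
    ∃ K > 0, ∀ (α : ℝ) (g : ℝ → ℝ), 0 < α → α ≤ Real.exp (-1) → (∀ k, 0 ≤ g (eig k)) →
      (∀ k, α * g (eig k) ≤ B) → (∀ k, eig k * g (eig k) ≤ 1) →
      varSum eig g ≤ K * (-Real.log α) ^ (1 / θ) / α := by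
  have hS := summable_exp_neg_rpow (half_pos hb) hθ
  set S := ∑' k : ℕ, Real.exp (-(b / 2) * ((k : ℝ) + 1) ^ θ) with hSdef
  have hS0 : 0 ≤ S := tsum_nonneg fun _ => (Real.exp_pos _).le
  refine ⟨(2 / b) ^ (1 / θ) * B + C * B ^ 2 * S, by positivity, ?_⟩
  intro α g hα hα1 hg0 hgB hg1
  set L := -Real.log α with hL
  have hL1 : 1 ≤ L := by
    have := Real.log_le_log hα hα1
    rw [Real.log_exp] at this
    linarith
  have hαL : Real.exp (-L) = α := by rw [hL, neg_neg, Real.exp_log hα]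
  have hgB' : ∀ k, g (eig k) ≤ B / α := fun k => by
    rw [le_div_iff₀ hα, mul_comm]; exact hgB k
  -- Beyond index `R`, half of the exponential decay is at most `α` and the other half remains
  -- summable. The terms before it are each at most `B / α`.
  set R := (2 * L / b) ^ (1 / θ) with hR
  have hR0 : 0 ≤ R := by positivity
  set n := ⌊R⌋₊ with hn
  set u : ℕ → ℝ := fun k => (if k < n then B / α else 0)
    + C * B ^ 2 / α * Real.exp (-(b / 2) * ((k : ℝ) + 1) ^ θ) with hu
  have hu1 : HasSum (fun k => if k < n then B / α else 0) (n * (B / α)) := by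
    have h0 : ∑ k ∈ Finset.range n, (if k < n then B / α else 0) = n * (B / α) := by
      rw [Finset.sum_congr rfl (g := fun _ => B / α) fun k hk => if_pos (Finset.mem_range.1 hk)]
      simp
    rw [← h0]
    exact hasSum_sum_of_ne_finset_zero fun k hk => if_neg (by simpa using hk)
  have hu2 : HasSum u (n * (B / α) + C * B ^ 2 / α * S) := hu1.add (hS.hasSum.mul_left _)
  have hle : ∀ k, eig k * g (eig k) ^ 2 ≤ u k := by
    intro k
    have hexp := Real.exp_pos (-(b / 2) * ((k : ℝ) + 1) ^ θ)
    by_cases hk : k < n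
    · have h1 : eig k * g (eig k) ^ 2 ≤ B / α := by
        calc eig k * g (eig k) ^ 2 = (eig k * g (eig k)) * g (eig k) := by ring
          _ ≤ 1 * (B / α) := mul_le_mul (hg1 k) (hgB' k) (hg0 k) zero_le_one
          _ = _ := one_mul _
      simp only [hu, if_pos hk]
      have : 0 ≤ C * B ^ 2 / α * Real.exp (-(b / 2) * ((k : ℝ) + 1) ^ θ) := by positivity
      linarith
    · have h1 : R < (k : ℝ) + 1 := by
        have : R < n + 1 := Nat.lt_floor_add_one R
        have h2 : (n : ℝ) ≤ k := by exact_mod_cast not_lt.1 hk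
        linarith
      have h2 : 2 * L / b ≤ ((k : ℝ) + 1) ^ θ := by
        have := Real.rpow_le_rpow hR0 h1.le hθ.le
        rwa [hR, ← Real.rpow_mul (by positivity), one_div_mul_cancel hθ.ne', Real.rpow_one] at this
      have h3 : eig k ≤ C * α * Real.exp (-(b / 2) * ((k : ℝ) + 1) ^ θ) := by
        refine (h k).trans ?_
        rw [mul_assoc, ← hαL, ← Real.exp_add]
        refine mul_le_mul_of_nonneg_left (Real.exp_le_exp.2 ?_) hC.le
        rw [div_le_iff₀ hb] at h2
        linarith
      simp only [hu, if_neg hk, zero_add]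
      calc eig k * g (eig k) ^ 2
          ≤ (C * α * Real.exp (-(b / 2) * ((k : ℝ) + 1) ^ θ)) * (B / α) ^ 2 :=
            mul_le_mul h3 (pow_le_pow_left₀ (hg0 k) (hgB' k) 2) (sq_nonneg _) (by positivity)
        _ = _ := by field_simp
  have hV : varSum eig g ≤ n * (B / α) + C * B ^ 2 / α * S := by
    rw [← hu2.tsum_eq]
    exact (Summable.of_nonneg_of_le (fun k => mul_nonneg (hpos k) (sq_nonneg _)) hle
      hu2.summable).tsum_le_tsum hle hu2.summable
  have hnR : (n : ℝ) ≤ (2 / b) ^ (1 / θ) * L ^ (1 / θ) := by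
    refine (Nat.floor_le hR0).trans_eq ?_
    rw [hR, ← Real.mul_rpow (by positivity) (by positivity)]
    congr 1; ring
  have hLθ : 1 ≤ L ^ (1 / θ) := Real.one_le_rpow hL1 (by positivity)
  refine hV.trans ?_
  rw [le_div_iff₀ hα]
  have e : (n * (B / α) + C * B ^ 2 / α * S) * α = n * B + C * B ^ 2 * S := by field_simp
  rw [e, add_mul]
  refine add_le_add ?_ (le_mul_of_one_le_right (by positivity) hLθ)
  nlinarith

/-- The counting function grows at least like a squared logarithm. -/
lemma exists_le_countEig (hb : 0 < b) (hθ : 0 < θ) (hθ' : θ ≤ 1 / 2)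
    (hfin : Tendsto eig cofinite (𝓝 0)) {C : ℝ} (hC : 0 < C)
    (h : ∀ k : ℕ, C * Real.exp (-b * ((k : ℝ) + 1) ^ θ) ≤ eig k) :
    ∃ κ > 0, ∀ᶠ x in 𝓝[>] (0 : ℝ), κ * (-Real.log x) ^ 2 ≤ countEig eig x := by
  refine ⟨(1 / (2 * b)) ^ 2 / 2, by positivity, ?_⟩
  have hlog : Tendsto (fun x : ℝ => -Real.log x) (𝓝[>] 0) atTop :=
    tendsto_neg_atBot_atTop.comp Real.tendsto_log_nhdsGT_zero
  filter_upwards [hlog.eventually_ge_atTop (4 * b), hlog.eventually_ge_atTop (-2 * Real.log C),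
    self_mem_nhdsWithin] with x hx1 hx2 hx
  have hx0 : 0 < x := hx
  set L := -Real.log x with hL
  have hL0 : 0 < L := by linarith
  -- Up to `R` the bound `θ ≤ 1/2` gives `b (k+1)^θ ≤ L/2`; the other `L/2` absorbs `log C`. Since
  -- `R ≥ 4`, taking the floor costs at most a factor two.
  set R := (L / (2 * b)) ^ 2 with hR
  have hR4 : 4 ≤ R := by
    have : 2 ≤ L / (2 * b) := by rw [le_div_iff₀ (by positivity)]; linarith
    nlinarith
  have hset : (Finset.range ⌊R⌋₊ : Set ℕ) ⊆ {k : ℕ | x ≤ eig k} := by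
    intro k hk
    have hk' : k < ⌊R⌋₊ := by simpa using hk
    have h1 : (k : ℝ) + 1 ≤ R := by
      have h2 : ((k + 1 : ℕ) : ℝ) ≤ ⌊R⌋₊ := by exact_mod_cast hk'
      push_cast at h2
      exact h2.trans (Nat.floor_le (by positivity))
    have h3 : ((k : ℝ) + 1) ^ θ ≤ L / (2 * b) := by
      calc ((k : ℝ) + 1) ^ θ ≤ ((k : ℝ) + 1) ^ (1 / 2 : ℝ) :=
            Real.rpow_le_rpow_of_exponent_le (by linarith [k.cast_nonneg (α := ℝ)]) hθ'
        _ ≤ R ^ (1 / 2 : ℝ) := Real.rpow_le_rpow (by positivity) h1 (by norm_num)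
        _ = L / (2 * b) := by rw [← Real.sqrt_eq_rpow, hR, Real.sqrt_sq (by positivity)]
    refine le_trans ?_ (h k)
    rw [le_div_iff₀ (by positivity)] at h3
    calc x = Real.exp (-L) := by rw [hL, neg_neg, Real.exp_log hx0]
      _ ≤ Real.exp (Real.log C + -b * ((k : ℝ) + 1) ^ θ) := Real.exp_le_exp.2 (by linarith)
      _ = _ := by rw [Real.exp_add, Real.exp_log hC]
  have hfinite : {k : ℕ | x ≤ eig k}.Finite := by
    have := hfin.eventually (gt_mem_nhds hx0)
    rw [eventually_cofinite] at this
    simpa only [not_lt] using this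
  have hcard := ncard_le_ncard hset hfinite
  rw [ncard_coe_finset, Finset.card_range] at hcard
  have h4 : (⌊R⌋₊ : ℝ) ≤ countEig eig x := by rw [countEig]; exact_mod_cast hcard
  have h5 : R < ⌊R⌋₊ + 1 := Nat.lt_floor_add_one R
  have e : (1 / (2 * b)) ^ 2 / 2 * L ^ 2 = R / 2 := by rw [hR]; ring
  rw [e]
  linarith

lemma tendsto_indexFun {ν τ : ℝ} (h : 0 < ν ∨ (ν = 0 ∧ 0 < τ)) :
    Tendsto (indexFun ν τ) (𝓝[>] 0) (𝓝 0) := by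
  have hlog : Tendsto (fun x : ℝ => -Real.log x) (𝓝[>] 0) atTop :=
    tendsto_neg_atBot_atTop.comp Real.tendsto_log_nhdsGT_zero
  rcases h with hν | ⟨rfl, hτ⟩
  · refine ((tendsto_rpow_mul_exp_neg_mul_atTop_nhds_zero (-τ) ν hν).comp hlog).congr' ?_
    filter_upwards [self_mem_nhdsWithin] with x hx
    have hx0 : 0 < x := hx
    simp only [Function.comp_apply]
    rw [indexFun, Real.rpow_def_of_pos hx0, mul_comm]
    congr 2; ring
  · refine ((tendsto_rpow_neg_atTop hτ).comp hlog).congr fun x => ?_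
    simp [indexFun]

lemma indexFun_nonneg {ν τ x : ℝ} (hx : 0 ≤ x) (hx1 : x ≤ 1) : 0 ≤ indexFun ν τ x :=
  mul_nonneg (Real.rpow_nonneg hx _)
    (Real.rpow_nonneg (neg_nonneg.2 (Real.log_nonpos hx hx1)) _)

/-- Positive powers beat logarithms near zero. -/
lemma eventually_rpow_mul_log_rpow_le {η : ℝ} (hη : 0 < η) (p : ℝ) {K : ℝ} (hK : 0 < K) :
    ∀ᶠ s in 𝓝[>] (0 : ℝ), s ^ η * (-Real.log s) ^ p ≤ K := by
  have h := tendsto_indexFun (ν := η) (τ := -p) (Or.inl hη)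
  filter_upwards [h.eventually (gt_mem_nhds hK)] with s hs
  rw [indexFun, neg_neg] at hs
  exact hs.le

/-- A power is monotone or antitone, so one endpoint dominates; the sum covers both signs of the
exponent, as needed for the logarithmic exponent of the rate. -/
lemma rpow_le_add_of_mem_Icc {x y z e : ℝ} (hy : 0 < y) (hx : x ∈ Icc y z) :
    x ^ e ≤ y ^ e + z ^ e := by
  have hx0 : 0 < x := hy.trans_le hx.1
  have hz0 : 0 < z := hx0.trans_le hx.2
  rcases le_total 0 e with he | he
  · have := Real.rpow_le_rpow hx0.le hx.2 he
    have := Real.rpow_nonneg hy.le e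
    linarith
  · have := Real.rpow_le_rpow_of_nonpos hy hx.1 he
    have := Real.rpow_nonneg hz0.le e
    linarith

end Analysis

/-! ### Balancing bias and variance -/

section Rate

/-- The rate of convergence as a function of `s = σ²`. -/
noncomputable def rate (ν τ ϑ s : ℝ) : ℝ :=
  s ^ (2 * ν / (2 * ν + 1)) * (-Real.log s) ^ ((2 * ν / ϑ - 2 * τ) / (2 * ν + 1))

lemma tendsto_neg_log_nhdsGT_zero : Tendsto (fun x : ℝ => -Real.log x) (𝓝[>] 0) atTop :=
  tendsto_neg_atBot_atTop.comp Real.tendsto_log_nhdsGT_zero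

lemma eventually_rpow_mul_log_rpow_le_rpow_mul {η₁ η₂ : ℝ} (hη : η₂ < η₁) (p₁ p₂ : ℝ) :
    ∀ᶠ s in 𝓝[>] (0 : ℝ),
      s ^ η₁ * (-Real.log s) ^ p₁ ≤ s ^ η₂ * (-Real.log s) ^ p₂ := by
  filter_upwards [eventually_rpow_mul_log_rpow_le (sub_pos.2 hη) (p₁ - p₂) one_pos,
    self_mem_nhdsWithin, tendsto_neg_log_nhdsGT_zero.eventually_gt_atTop 0] with s hs hs0 hL
  have hs0' : 0 < s := hs0
  rw [Real.rpow_sub hs0', Real.rpow_sub hL, div_mul_div_comm, div_le_one (by positivity)] at hs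
  exact hs

lemma eventually_rpow_mul_log_rpow_le_rate {ν η : ℝ} (hη : 2 * ν / (2 * ν + 1) < η)
    (τ ϑ p : ℝ) :
    ∀ᶠ s in 𝓝[>] (0 : ℝ), s ^ η * (-Real.log s) ^ p ≤ rate ν τ ϑ s :=
  eventually_rpow_mul_log_rpow_le_rpow_mul hη _ _

/-- Balancing the approximation error against the variance. -/
lemma exists_balance_le_rate {ν τ ϑ : ℝ} (hν : 0 ≤ ν) {C₁ C₂ C₃ : ℝ} (hC₁ : 0 < C₁)
    (hC₂ : 0 < C₂) (hC₃ : 0 < C₃) (hϑ : 0 < ϑ) :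
    ∃ C > 0, ∀ᶠ s in 𝓝[>] (0 : ℝ), ∀ α v, 0 < α → α ≤ Real.exp (-1) → 0 < v →
      v ≤ C₁ * indexFun ν τ α ^ 2 → v ≤ C₂ * (s * ((-Real.log α) ^ (1 / ϑ) / α)) →
      -Real.log α ≤ C₃ * -Real.log s → v ≤ C * rate ν τ ϑ s := by
  set w := 2 * ν + 1 with hw
  have hw0 : 0 < w := by positivity
  set e := (2 * ν / ϑ - 2 * τ) / w with he
  -- Any value below `1/w` would do: it makes `1 - κ` exceed the exponent `2ν/w` of the rate.
  set κ := 1 / (2 * w) with hκ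
  have hκ0 : 0 < κ := by positivity
  set A := Real.exp (1 / w * Real.log C₁ + 2 * ν / w * Real.log C₂) with hA
  have hη : 2 * ν / (2 * ν + 1) < 1 - κ := by
    rw [← hw, hκ, div_lt_iff₀ hw0]
    have : 1 / (2 * w) * w = 1 / 2 := by field_simp
    linarith
  refine ⟨A * (κ ^ e + C₃ ^ e) + C₂ * κ ^ (1 / ϑ), by positivity, ?_⟩
  filter_upwards [eventually_rpow_mul_log_rpow_le_rate hη τ ϑ (1 / ϑ), self_mem_nhdsWithin,
    tendsto_neg_log_nhdsGT_zero.eventually_ge_atTop 1] with s hs hs0 hΛ1 α v hα hα1 hv h1 h2 h3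
  have hs0' : 0 < s := hs0
  set L := -Real.log α with hL
  set Λ := -Real.log s with hΛ
  have hL1 : 1 ≤ L := by
    have := Real.log_le_log hα hα1
    rw [Real.log_exp] at this
    linarith
  have hL0 : 0 < L := by linarith
  have hΛ0 : 0 < Λ := by linarith
  have hαL : α = Real.exp (-L) := by rw [hL, neg_neg, Real.exp_log hα]
  have hrate : 0 < rate ν τ ϑ s := mul_pos (Real.rpow_pos_of_pos hs0' _)
    (Real.rpow_pos_of_pos hΛ0 _)
  rw [add_mul]
  rcases le_or_gt (κ * Λ) L with hcase | hcase
  · have hl1 : Real.log v ≤ Real.log C₁ + 2 * (-ν * L - τ * Real.log L) := by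
      refine (Real.log_le_log hv h1).trans_eq ?_
      have hpos : 0 < indexFun ν τ α :=
        mul_pos (Real.rpow_pos_of_pos hα _) (Real.rpow_pos_of_pos hL0 _)
      rw [Real.log_mul hC₁.ne' (by positivity), Real.log_pow, indexFun,
        Real.log_mul (Real.rpow_pos_of_pos hα _).ne' (Real.rpow_pos_of_pos hL0 _).ne',
        Real.log_rpow hα, Real.log_rpow hL0]
      push_cast
      ring
    have hl2 : Real.log v ≤ Real.log C₂ - Λ + 1 / ϑ * Real.log L + L := by
      refine (Real.log_le_log hv h2).trans_eq ?_
      rw [Real.log_mul hC₂.ne' (by positivity), Real.log_mul hs0'.ne' (by positivity),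
        Real.log_div (by positivity) hα.ne', Real.log_rpow hL0]
      ring
    -- The weights `1/w` and `2ν/w` sum to one and cancel the terms `-2νL` and `L`, which eliminates
    -- the powers of `α`.
    have hl : Real.log v ≤ (1 / w * Real.log C₁ + 2 * ν / w * Real.log C₂)
        + Real.log s * (2 * ν / w) + Real.log L * e := by
      have e1 : 1 / w * (Real.log C₁ + 2 * (-ν * L - τ * Real.log L))
          + 2 * ν / w * (Real.log C₂ - Λ + 1 / ϑ * Real.log L + L)
          = (1 / w * Real.log C₁ + 2 * ν / w * Real.log C₂)
            + Real.log s * (2 * ν / w) + Real.log L * e := by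
        rw [he, hΛ]; field_simp; ring
      have e2 : Real.log v = 1 / w * Real.log v + 2 * ν / w * Real.log v := by
        rw [← add_mul, ← add_div, add_comm (1 : ℝ), ← hw, div_self hw0.ne', one_mul]
      rw [e2, ← e1]
      gcongr
    have hv1 : v ≤ A * s ^ (2 * ν / w) * L ^ e := by
      rw [← Real.exp_log hv, hA, Real.rpow_def_of_pos hs0', Real.rpow_def_of_pos hL0,
        ← Real.exp_add, ← Real.exp_add]
      exact Real.exp_le_exp.2 hl
    have hLe : L ^ e ≤ (κ ^ e + C₃ ^ e) * Λ ^ e := by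
      have h4 : L / Λ ∈ Icc κ C₃ :=
        ⟨(le_div_iff₀ hΛ0).2 hcase, (div_le_iff₀ hΛ0).2 h3⟩
      have h5 : L ^ e = (L / Λ) ^ e * Λ ^ e := by
        rw [← Real.mul_rpow (by positivity) hΛ0.le, div_mul_cancel₀ _ hΛ0.ne']
      rw [h5]
      exact mul_le_mul_of_nonneg_right (rpow_le_add_of_mem_Icc hκ0 h4) (by positivity)
    have hfin : v ≤ A * (κ ^ e + C₃ ^ e) * rate ν τ ϑ s := by
      refine hv1.trans ?_
      rw [rate, ← hw, ← he, ← hΛ]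
      calc A * s ^ (2 * ν / w) * L ^ e
          ≤ A * s ^ (2 * ν / w) * ((κ ^ e + C₃ ^ e) * Λ ^ e) := by gcongr
        _ = _ := by ring
    have : 0 ≤ C₂ * κ ^ (1 / ϑ) * rate ν τ ϑ s := by positivity
    linarith
  -- Here `α > s ^ κ`, and the variance bound alone gives order `s ^ (1 - κ)` up to logarithms,
  -- which is below the rate.
  · have h4 : L ^ (1 / ϑ) ≤ κ ^ (1 / ϑ) * Λ ^ (1 / ϑ) := by
      rw [← Real.mul_rpow hκ0.le hΛ0.le]
      exact Real.rpow_le_rpow hL0.le hcase.le (by positivity)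
    have h5 : 1 / α ≤ s ^ (-κ) := by
      rw [hαL, one_div, ← Real.exp_neg, neg_neg, Real.rpow_def_of_pos hs0']
      exact Real.exp_le_exp.2 (by rw [hΛ] at hcase; linarith)
    have h6 : s * s ^ (-κ) = s ^ (1 - κ) := by
      rw [sub_eq_add_neg, Real.rpow_add hs0', Real.rpow_one]
    have h7 : v ≤ C₂ * κ ^ (1 / ϑ) * rate ν τ ϑ s := by
      calc v ≤ C₂ * (s * (L ^ (1 / ϑ) * (1 / α))) := by rw [mul_one_div]; exact h2
        _ ≤ C₂ * (s * ((κ ^ (1 / ϑ) * Λ ^ (1 / ϑ)) * s ^ (-κ))) := by gcongr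
        _ = C₂ * κ ^ (1 / ϑ) * (s ^ (1 - κ) * Λ ^ (1 / ϑ)) := by rw [← h6]; ring
        _ ≤ _ := by gcongr
    have : 0 ≤ A * (κ ^ e + C₃ ^ e) * rate ν τ ϑ s := by positivity
    linarith

end Rate

/-! ### Variances, levels and number of the candidates -/

section Candidates

variable {X Y : Type*}
  [NormedAddCommGroup X] [InnerProductSpace ℝ X] [CompleteSpace X]
  [NormedAddCommGroup Y] [InnerProductSpace ℝ Y] [CompleteSpace Y]
  {T : X →L[ℝ] Y} {D : EigenDecomposition T} {A : Set ℝ} {q : ℝ → ℝ → ℝ} {α : ℕ → ℝ}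
  {θ θ₂ B : ℝ}

lemma IsOrderedFilter.exists_mul_le
    (hq : IsOrderedFilter ‖(ContinuousLinearMap.adjoint T) ∘L T‖ A q) :
    ∃ B > 0, ∀ α ∈ A, ∀ k, α * q α (D.eig k) ≤ B := by
  obtain ⟨C, hC⟩ := hq.mul_le
  exact ⟨max C 1, by positivity,
    fun α hα k => (hC α hα _ (D.eig_mem_Icc k)).trans (le_max_left _ _)⟩

lemma eig_mul_sq_le {g : ℝ → ℝ} {x : ℝ} (hx : 0 < x) (h0 : ∀ k, 0 ≤ g (D.eig k))
    (h : ∀ k, x * g (D.eig k) ≤ B) (k : ℕ) :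
    D.eig k * g (D.eig k) ^ 2 ≤ (B / x) ^ 2 * D.eig k := by
  rw [mul_comm]
  refine mul_le_mul_of_nonneg_right (pow_le_pow_left₀ (h0 k) ?_ 2) (D.eig_nonneg k)
  rw [le_div_iff₀ hx, mul_comm]
  exact h k

lemma IsOrderedFilter.isSpectralFilter
    (hq : IsOrderedFilter ‖(ContinuousLinearMap.adjoint T) ∘L T‖ A q) (hsum : Summable D.eig)
    {x : ℝ} (hx : x ∈ A) : IsSpectralFilter D (q x) := by
  obtain ⟨B, -, hB⟩ := hq.exists_mul_le (D := D)
  refine ⟨fun k => hq.nonneg x hx _ (D.eig_mem_Icc k),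
    fun k => hq.mul_le_one x hx _ (D.eig_mem_Icc k), ?_⟩
  exact Summable.of_nonneg_of_le (fun k => mul_nonneg (D.eig_nonneg k) (sq_nonneg _))
    (eig_mul_sq_le (hq.pos x hx) (fun k => hq.nonneg x hx _ (D.eig_mem_Icc k)) (hB x hx))
    (hsum.mul_left _)

/-- This crude `α⁻²` bound suffices where only `α → 0` or the logarithm of the variance matters. -/
lemma IsOrderedFilter.varSum_le
    (hq : IsOrderedFilter ‖(ContinuousLinearMap.adjoint T) ∘L T‖ A q) (hsum : Summable D.eig)
    (hB : ∀ α ∈ A, ∀ k, α * q α (D.eig k) ≤ B) {x : ℝ} (hx : x ∈ A) :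
    varSum D.eig (q x) ≤ (B / x) ^ 2 * ∑' k, D.eig k := by
  rw [← tsum_mul_left]
  exact (hq.isSpectralFilter hsum hx).summable.tsum_le_tsum
    (eig_mul_sq_le (hq.pos x hx) (fun k => hq.nonneg x hx _ (D.eig_mem_Icc k)) (hB x hx))
    (hsum.mul_left _)

lemma IsOrderedFilter.isGeometricFamily
    (hq : IsOrderedFilter ‖(ContinuousLinearMap.adjoint T) ∘L T‖ A q) (hsum : Summable D.eig)
    (hα : StrictAnti α) (hαA : ∀ m, α m ∈ A) (hθ : 1 < θ)
    (hV : ∀ m, θ ≤ varSum D.eig (q (α (m + 1))) / varSum D.eig (q (α m))) :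
    IsGeometricFamily D q α θ := by
  have hpos : ∀ m, 0 < varSum D.eig (q (α m)) := by
    intro m
    -- A vanishing variance would make the next ratio `0` by the division convention, contradicting
    -- `θ ≤` ratio.
    refine (varSum_nonneg _).lt_of_ne fun h0 => ?_
    have := hV m
    rw [← h0, div_zero] at this
    linarith
  refine ⟨fun m => hq.isSpectralFilter hsum (hαA m), fun {m n} hmn k => ?_, hθ, hpos,
    fun m => (le_div_iff₀ (hpos m)).1 (hV m)⟩
  exact hq.ordered _ (hαA m) _ (hαA n) (hα.antitone hmn) _ (D.eig_mem_Icc k)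

/-- The regularization parameters of the candidates tend to zero. -/
lemma IsGeometricFamily.tendsto_alpha (h : IsGeometricFamily D q α θ)
    (hq : IsOrderedFilter ‖(ContinuousLinearMap.adjoint T) ∘L T‖ A q) (hsum : Summable D.eig)
    (hαA : ∀ m, α m ∈ A) : Tendsto α atTop (𝓝[A] 0) := by
  refine tendsto_nhdsWithin_iff.2 ⟨?_, Eventually.of_forall hαA⟩
  obtain ⟨B, hB0, hB⟩ := hq.exists_mul_le (D := D)
  refine tendsto_order.2 ⟨fun x hx => Eventually.of_forall fun m => hx.trans (hq.pos _ (hαA m)),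
    fun x hx => ?_⟩
  have hbig := h.tendsto_varSum.eventually_gt_atTop ((B / x) ^ 2 * ∑' k, D.eig k)
  filter_upwards [hbig] with m hm
  by_contra hle
  have hle' : x ≤ α m := not_lt.1 hle
  refine absurd (hq.varSum_le hsum hB (hαA m)) (not_le.2 (lt_of_le_of_lt ?_ hm))
  refine mul_le_mul_of_nonneg_right ?_ (tsum_nonneg D.eig_nonneg)
  exact pow_le_pow_left₀ (div_nonneg hB0.le (hq.pos _ (hαA m)).le)
    (div_le_div_of_nonneg_left hB0.le hx hle') 2

/-- Lower bound for the variance of the candidates. -/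
lemma exists_le_varSum {S : ℝ → ℝ} {cv κ : ℝ} (hS : IsSmoothSurrogate D.eig A S)
    (hlim : Tendsto α atTop (𝓝[A] 0)) (hpos : ∀ m, 0 < α m) (hcv : 0 < cv) (hκ : 0 < κ)
    (heig : 0 < D.eig 0)
    (hvar : ∀ m, α m ≤ D.eig 0 →
      cv * (S (α m) / (-Real.log (α m) * α m)) ≤ varSum D.eig (q (α m)))
    (hcount : ∀ᶠ x in 𝓝[>] (0 : ℝ), κ * (-Real.log x) ^ 2 ≤ countEig D.eig x) :
    ∃ c > 0, ∀ᶠ m in atTop, c * (-Real.log (α m) / α m) ≤ varSum D.eig (q (α m)) := by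
  -- Eventually `S ≥ ε Σ ≥ ε κ L²`, so after division by `Lα` one factor `L` survives.
  obtain ⟨ε, hε0, hε⟩ := ENNReal.lt_iff_exists_nnreal_btwn.1 hS.liminf_pos
  have hε0' : (0 : ℝ) < ε := by exact_mod_cast hε0
  have hlim' : Tendsto α atTop (𝓝[>] 0) :=
    tendsto_nhdsWithin_iff.2 ⟨(tendsto_nhdsWithin_iff.1 hlim).1, Eventually.of_forall hpos⟩
  refine ⟨cv * (ε * κ), by positivity, ?_⟩
  filter_upwards [hlim.eventually (eventually_lt_of_lt_liminf hε), hlim'.eventually hcount,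
    (tendsto_neg_log_nhdsGT_zero.comp hlim').eventually_gt_atTop 0,
    (tendsto_nhdsWithin_iff.1 hlim).1.eventually (gt_mem_nhds heig)] with m h1 h2 h3 h4
  have hL0 : 0 < -Real.log (α m) := h3
  have hαm := hpos m
  refine le_trans ?_ (hvar m h4.le)
  have hcnt : 0 < countEig D.eig (α m) := lt_of_lt_of_le (by positivity) h2
  have h5 : (ε : ℝ) ≤ S (α m) / countEig D.eig (α m) := by
    rw [← ENNReal.ofReal_coe_nnreal] at h1
    exact (ENNReal.ofReal_lt_ofReal_iff'.1 h1).1.le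
  rw [le_div_iff₀ hcnt] at h5
  have h6 : ε * (κ * (-Real.log (α m)) ^ 2) ≤ S (α m) :=
    (mul_le_mul_of_nonneg_left h2 hε0'.le).trans h5
  rw [mul_assoc]
  refine mul_le_mul_of_nonneg_left ?_ hcv.le
  rw [le_div_iff₀ (by positivity)]
  refine le_trans (le_of_eq ?_) h6
  field_simp

/-- The levels grow at most logarithmically in the regularization parameter. -/
lemma IsGeometricFamily.exists_level_le (h : IsGeometricFamily D q α θ)
    (hq : IsOrderedFilter ‖(ContinuousLinearMap.adjoint T) ∘L T‖ A q) (hsum : Summable D.eig)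
    (heig : 0 < D.eig 0) (hαA : ∀ m, α m ∈ A)
    (hV : ∀ m, varSum D.eig (q (α (m + 1))) ≤ θ₂ * varSum D.eig (q (α m))) {γ : ℝ}
    (hγ : 0 < γ) :
    ∃ K > 0, ∀ σ : ℝ, 0 < σ → ∀ m, α m ≤ Real.exp (-1) →
      level D.eig q α γ σ m ≤ K * -Real.log (α m) := by
  obtain ⟨B, hB0, hB⟩ := hq.exists_mul_le (D := D)
  have hs : 0 < ∑' k, D.eig k := hsum.tsum_pos (fun k => D.eig_nonneg k) 0 heig
  have hV0 := h.pos 0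
  have hθ₂ : 0 < θ₂ := by
    by_contra hneg
    have h1 := (h.pos 1).trans_le (hV 0)
    nlinarith
  set Q := θ₂ * (B ^ 2 * ∑' k, D.eig k) / varSum D.eig (q (α 0)) with hQ
  have hQ0 : 0 < Q := by positivity
  refine ⟨2 * (1 + γ) * (|Real.log Q| + 2), by positivity, fun σ hσ m hm => ?_⟩
  have hαm := hq.pos _ (hαA m)
  have hL1 : 1 ≤ -Real.log (α m) := by
    have := Real.log_le_log hαm hm
    rw [Real.log_exp] at this
    linarith
  rw [level, mul_div_mul_left _ _ (by positivity), mul_assoc (2 * (1 + γ))]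
  refine mul_le_mul_of_nonneg_left ?_ (by positivity)
  -- The upper growth factor `θ₂` is what permits a bound in `α m`; nothing bounds `α (m + 1)` from
  -- below in terms of it.
  have h1 : varSum D.eig (q (α (m + 1))) / varSum D.eig (q (α 0)) ≤ Q / α m ^ 2 := by
    have h2 := (hV m).trans (mul_le_mul_of_nonneg_left (hq.varSum_le hsum hB (hαA m)) hθ₂.le)
    rw [div_le_iff₀ hV0]
    refine h2.trans_eq ?_
    rw [hQ]
    field_simp
  refine (Real.log_le_log (div_pos (h.pos _) hV0) h1).trans ?_
  rw [Real.log_div hQ0.ne' (by positivity), Real.log_pow]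
  have h3 := le_abs_self (Real.log Q)
  have h4 := abs_nonneg (Real.log Q)
  push_cast
  nlinarith

variable {Ω : Type*} [MeasurableSpace Ω] {P : Measure Ω} [IsProbabilityMeasure P]
  {ξ : Y →ₗ[ℝ] Lp ℝ 2 P}

/-- The critical values are at most of the order of the standard deviation. -/
lemma IsGeometricFamily.critValue_le (h : IsGeometricFamily D q α θ) (hξ : IsWhiteNoise P ξ)
    {γ σ K c : ℝ} (hγ : 0 < γ) (hσ : 0 < σ) (hB0 : 0 < B) (hc : 0 < c) (hK : 0 ≤ K) {m n : ℕ}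
    (hmn : m < n) (hα : 0 < α n) (hB : ∀ k, α n * q (α n) (D.eig k) ≤ B)
    (hlevel : level D.eig q α γ σ n ≤ K * -Real.log (α n))
    (hV : c * (-Real.log (α n) / α n) ≤ varSum D.eig (q (α n))) :
    critValue D ξ (q (α m)) (q (α n)) (level D.eig q α γ σ m)
      ≤ √(2 + 4 * B * K / c) * √(varSum D.eig (q (α n))) := by
  -- One factor of `λ q²` is used through `λ q ≤ 1`, so the largest weight is of order `1/α` rather
  -- than `1/α²`.
  have hM : ∀ k, D.eig k * (q (α m) (D.eig k) - q (α n) (D.eig k)) ^ 2 ≤ B / α n := by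
    intro k
    refine (h.sq_sub_le hmn.le k).trans ?_
    have h1 := (h.filter n).mul_le_one k
    have h2 := (h.filter n).nonneg k
    have h3 : q (α n) (D.eig k) ≤ B / α n := by
      rw [le_div_iff₀ hα, mul_comm]; exact hB k
    calc D.eig k * q (α n) (D.eig k) ^ 2
        = (D.eig k * q (α n) (D.eig k)) * q (α n) (D.eig k) := by ring
      _ ≤ 1 * (B / α n) := mul_le_mul h1 h3 h2 zero_le_one
      _ = _ := one_mul _
  have hlev := (h.level_mono hσ hγ hmn.le).trans hlevel
  have hlev0 := h.level_nonneg hσ hγ m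
  refine (hξ.critValue_le (h.filter m).summable (h.filter n).summable (h.summable_sub hmn.le)
    (by positivity) hlev0 hM).trans ?_
  rw [← Real.sqrt_mul (by positivity)]
  refine Real.sqrt_le_sqrt ?_
  have h1 := h.varSum_sub_le hmn.le
  have h2 : 4 * (B / α n) * level D.eig q α γ σ m
      ≤ 4 * B * K / c * varSum D.eig (q (α n)) := by
    calc 4 * (B / α n) * level D.eig q α γ σ m
        ≤ 4 * (B / α n) * (K * -Real.log (α n)) := by gcongr
      _ = 4 * B * K / c * (c * (-Real.log (α n) / α n)) := by field_simp
      _ ≤ _ := by gcongr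
  rw [add_mul]
  linarith

/-- The number of candidates is logarithmic in the noise level. -/
lemma IsGeometricFamily.exists_mMax_le (h : IsGeometricFamily D q α θ) :
    ∃ K > 0, ∀ σ : ℝ, 0 < σ → 1 ≤ -Real.log (σ ^ 2) →
      (mMax D.eig q α σ : ℝ) ≤ K * -Real.log (σ ^ 2) := by
  have hθ := h.one_lt
  have hlogθ : 0 < Real.log θ := Real.log_pos hθ
  have hV0 := h.pos 0
  refine ⟨1 + (1 + |Real.log (varSum D.eig (q (α 0)))|) / Real.log θ, by positivity,
    fun σ hσ hΛ => ?_⟩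
  set Λ := -Real.log (σ ^ 2) with hΛdef
  rcases Nat.eq_zero_or_pos (mMax D.eig q α σ) with h0 | h0
  · rw [h0]; push_cast; positivity
  obtain ⟨j, hj⟩ : ∃ j, mMax D.eig q α σ = j + 1 := ⟨mMax D.eig q α σ - 1, by omega⟩
  -- Just before stopping the variance is still below one, while it has grown at least like `θ ^ j`.
  have h1 : σ ^ 2 * varSum D.eig (q (α j)) < 1 :=
    IsGeometricFamily.lt_one_of_lt_mMax (by omega)
  have h2 : σ ^ 2 * (θ ^ j * varSum D.eig (q (α 0))) < 1 :=
    (mul_le_mul_of_nonneg_left (h.pow_mul_le j) (sq_nonneg σ)).trans_lt h1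
  have hθj : 0 < θ ^ j := by positivity
  have h3 := Real.log_lt_log (by positivity) h2
  rw [Real.log_one, Real.log_mul (by positivity) (by positivity),
    Real.log_mul (by positivity) (by positivity), Real.log_pow θ j] at h3
  have h4 := neg_abs_le (Real.log (varSum D.eig (q (α 0))))
  have h5 : (j : ℝ) ≤ (Λ + |Real.log (varSum D.eig (q (α 0)))|) / Real.log θ := by
    rw [le_div_iff₀ hlogθ]; linarith
  have h6 : (Λ + |Real.log (varSum D.eig (q (α 0)))|) / Real.log θ
      ≤ (1 + |Real.log (varSum D.eig (q (α 0)))|) / Real.log θ * Λ := by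
    rw [div_mul_eq_mul_div]
    gcongr
    nlinarith [abs_nonneg (Real.log (varSum D.eig (q (α 0))))]
  rw [hj]
  push_cast
  linarith

end Candidates

/-! ### Approximation error on the source set -/

section Main

variable {X Y : Type*}
  [NormedAddCommGroup X] [InnerProductSpace ℝ X] [CompleteSpace X]
  [NormedAddCommGroup Y] [InnerProductSpace ℝ Y] [CompleteSpace Y]
  {T : X →L[ℝ] Y} {D : EigenDecomposition T} {A : Set ℝ} {q : ℝ → ℝ → ℝ} {α : ℕ → ℝ}
  {θ θ₂ ν τ ρ : ℝ}

/-- The approximation error on the source set is controlled by the qualification. -/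
lemma IsOrderedFilter.exists_norm_residual_le
    (hq : IsOrderedFilter ‖(ContinuousLinearMap.adjoint T) ∘L T‖ A q) (hsum : Summable D.eig)
    (hpos : ∀ k, 0 < D.eig k) (hle : ∀ k, D.eig k ≤ 1) (hντ : 0 < ν ∨ (ν = 0 ∧ 0 < τ))
    (hρ : 0 < ρ)
    (hqual : IsQualification ‖(ContinuousLinearMap.adjoint T) ∘L T‖ (D.eig 0) A q
      (indexFun ν τ)) :
    ∃ C > 0, ∀ f ∈ sourceSet D (indexFun ν τ) ρ, ∀ x ∈ A, x ≤ D.eig 0 →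
      ‖residual D (q x) f‖ ≤ C * indexFun ν τ x := by
  obtain ⟨C, hC⟩ := hqual
  have hlim : Tendsto D.eig atTop (𝓝[>] 0) :=
    tendsto_nhdsWithin_iff.2 ⟨hsum.tendsto_atTop_zero, Eventually.of_forall hpos⟩
  -- Boundedness of `φ` along the eigenvalues makes `specOp` act coefficientwise.
  obtain ⟨M, hM⟩ := ((tendsto_indexFun hντ).comp hlim).abs.bddAbove_range
  refine ⟨(|C| + 1) * ρ, by positivity, ?_⟩
  rintro f ⟨g, hg, rfl⟩ x hx hx0
  have hφx : 0 ≤ indexFun ν τ x := indexFun_nonneg (hq.pos x hx).le (hx0.trans (hle 0))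
  have h1 : ‖residual D (q x) (specOp D (indexFun ν τ) g)‖
      ≤ (|C| + 1) * indexFun ν τ x * ‖g‖ := by
    refine (hq.isSpectralFilter hsum hx).norm_residual_specOp_le
      (fun k => hM (mem_range_self k)) (by positivity) (fun k => ?_) g
    rw [abs_of_nonneg (mul_nonneg (indexFun_nonneg (hpos k).le (hle k))
      (by linarith [hq.mul_le_one x hx _ (D.eig_mem_Icc k)]))]
    refine (hC x hx hx0 _ (D.eig_mem_Icc k)).trans (mul_le_mul_of_nonneg_right ?_ hφx)
    linarith [le_abs_self C]
  refine h1.trans ?_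
  calc (|C| + 1) * indexFun ν τ x * ‖g‖ ≤ (|C| + 1) * indexFun ν τ x * ρ := by gcongr
    _ = _ := by ring

end Main

end Solit

/-! ### Assembly of the rate -/

open Solit in
theorem mainTheorem2 {X Y : Type*}
    [NormedAddCommGroup X] [InnerProductSpace ℝ X] [CompleteSpace X]
    [TopologicalSpace.SeparableSpace X]
    [NormedAddCommGroup Y] [InnerProductSpace ℝ Y] [CompleteSpace Y]
    [TopologicalSpace.SeparableSpace Y]
    (T : X →L[ℝ] Y) (hinj : Function.Injective T) (hHS : Solit.IsHilbertSchmidt T)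
    (D : Solit.EigenDecomposition T) (hnorm : D.eig 0 ≤ Real.exp (-1))
    -- exponential decay of the eigenvalues
    (a b ϑ cmin cmax : ℝ) (hb : 0 < b) (hϑ : 0 < ϑ) (hϑ' : ϑ ≤ 1 / 2)
    (hcmin : 0 < cmin) (hcmax : cmin ≤ cmax)
    (hlower : ∀ k : ℕ,
      cmin * ((k : ℝ) + 1) ^ (-a) * Real.exp (-b * ((k : ℝ) + 1) ^ ϑ) ≤ D.eig k)
    (hupper : ∀ k : ℕ,
      D.eig k ≤ cmax * ((k : ℝ) + 1) ^ (-a) * Real.exp (-b * ((k : ℝ) + 1) ^ ϑ))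
    -- smoothness class
    (ν τ ρ : ℝ) (hντ : 0 < ν ∨ (ν = 0 ∧ 0 < τ)) (hρ : 0 < ρ)
    -- ordered filter with qualification, and smooth surrogate
    (A : Set ℝ) (q : ℝ → ℝ → ℝ)
    (hq : Solit.IsOrderedFilter ‖(ContinuousLinearMap.adjoint T) ∘L T‖ A q)
    (hqual : Solit.IsQualification ‖(ContinuousLinearMap.adjoint T) ∘L T‖ (D.eig 0) A q
      (Solit.indexFun ν τ))
    (S : ℝ → ℝ) (hS : Solit.IsSmoothSurrogate D.eig A S)
    -- candidates with geometrically growing variance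
    (α : ℕ → ℝ) (hα : StrictAnti α) (hαA : ∀ m, α m ∈ A)
    (θ₁ θ₂ : ℝ) (hθ₁ : 1 < θ₁)
    (hV : ∀ m : ℕ,
      θ₁ ≤ Solit.varSum D.eig (q (α (m + 1))) / Solit.varSum D.eig (q (α m)) ∧
      Solit.varSum D.eig (q (α (m + 1))) / Solit.varSum D.eig (q (α m)) ≤ θ₂)
    -- lower bound on the variance
    (cv : ℝ) (hcv : 0 < cv)
    (hvar : ∀ m : ℕ, α m ≤ D.eig 0 →
      cv * (S (α m) / (-Real.log (α m) * α m)) ≤ Solit.varSum D.eig (q (α m)))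
    -- tuning constants of SOLIT
    (β γ : ℝ) (hβ : 0 < β) (hγ : 0 < γ) :
    ∃ C > 0, ∃ σ₀ ∈ Set.Ioo (0 : ℝ) 1, ∀ σ ∈ Set.Ioo 0 σ₀,
      ∀ (Ω : Type*) [MeasurableSpace Ω] (P : MeasureTheory.Measure Ω)
        [MeasureTheory.IsProbabilityMeasure P]
        (ξ : Y →ₗ[ℝ] MeasureTheory.Lp ℝ 2 P), Solit.IsWhiteNoise P ξ →
        (⨆ f ∈ Solit.sourceSet D (Solit.indexFun ν τ) ρ, Solit.solitMSE D ξ q α β γ σ f) ≤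
          ENNReal.ofReal (C * (σ ^ 2) ^ (2 * ν / (2 * ν + 1)) *
            (-Real.log (σ ^ 2)) ^ ((2 * ν / ϑ - 2 * τ) / (2 * ν + 1))) := by
  have hν : 0 ≤ ν := by rcases hντ with h | h; exacts [h.le, h.1.ge]
  have hcmax0 : 0 < cmax := hcmin.trans_le hcmax
  -- decay of the eigenvalues
  obtain ⟨Cu, hCu0, hCu⟩ := exists_le_exp_neg_rpow hb hϑ hcmax0 hupper
  obtain ⟨Cl, hCl0, hCl⟩ := exists_exp_neg_rpow_le hb hϑ hcmin hlower
  have hsum : Summable D.eig := Summable.of_nonneg_of_le D.eig_nonneg hCu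
    ((summable_exp_neg_rpow (half_pos hb) hϑ).mul_left Cu)
  have hpos : ∀ k, 0 < D.eig k := fun k => lt_of_lt_of_le (by positivity) (hCl k)
  have hexp1 : Real.exp (-1) ≤ 1 := Real.exp_le_one_iff.2 (by norm_num)
  have hle : ∀ k, D.eig k ≤ 1 := fun k =>
    (D.antitone_eig k.zero_le).trans (hnorm.trans hexp1)
  obtain ⟨κ, hκ0, hκ⟩ := exists_le_countEig (mul_pos two_pos hb) hϑ hϑ'
    hsum.tendsto_cofinite_zero hCl0 hCl
  -- the candidates
  have hfam := hq.isGeometricFamily hsum hα hαA hθ₁ fun m => (hV m).1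
  have hV2 : ∀ m, varSum D.eig (q (α (m + 1))) ≤ θ₂ * varSum D.eig (q (α m)) := fun m =>
    (div_le_iff₀ (hfam.pos m)).1 (hV m).2
  have hαpos : ∀ m, 0 < α m := fun m => hq.pos _ (hαA m)
  have hlim := hfam.tendsto_alpha hq hsum hαA
  have hlim0 : Filter.Tendsto α Filter.atTop (𝓝 0) := (tendsto_nhdsWithin_iff.1 hlim).1
  have hlim' : Filter.Tendsto α Filter.atTop (𝓝[>] 0) :=
    tendsto_nhdsWithin_iff.2 ⟨hlim0, Filter.Eventually.of_forall hαpos⟩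
  obtain ⟨B, hB0, hB⟩ := hq.exists_mul_le (D := D)
  obtain ⟨Kv, hKv0, hKv⟩ := exists_varSum_le (half_pos hb) hϑ D.eig_nonneg hCu0 hCu hB0
  obtain ⟨c, hc0, hc⟩ := exists_le_varSum hS hlim hαpos hcv hκ0 (hpos 0) hvar hκ
  obtain ⟨Kl, hKl0, hKl⟩ := hfam.exists_level_le hq hsum (hpos 0) hαA hV2 hγ
  obtain ⟨Kn, hKn0, hKn⟩ := hfam.exists_mMax_le
  obtain ⟨Cb, hCb0, hCb⟩ := hq.exists_norm_residual_le hsum hpos hle hντ hρ hqual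
  set b' : ℝ := β * √((θ₁ - 1) ^ 2 / (2 * (θ₁ + 1))) with hb'
  have hb'0 : 0 < b' := by
    have : 0 < θ₁ - 1 := by linarith
    positivity
  have hφlim : Filter.Tendsto (fun m => Cb * indexFun ν τ (α m)) Filter.atTop (𝓝 0) := by
    simpa using ((tendsto_indexFun hντ).comp hlim').const_mul Cb
  -- A cutoff independent of the noise, beyond which the variance bound holds, `α m` is at most the
  -- top eigenvalue, and the bias bound is below `b'`.
  obtain ⟨M, hM⟩ := Filter.eventually_atTop.1 (hc.and ((hlim0.eventually (gt_mem_nhds (hpos 0))).and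
    (hφlim.eventually (gt_mem_nhds hb'0))))
  have hαM : ∀ m, M ≤ m → α m ≤ D.eig 0 := fun m hm => (hM m hm).2.1.le
  have hαM' : ∀ m, M ≤ m → α m ≤ Real.exp (-1) := fun m hm => (hαM m hm).trans hnorm
  have hθ₂ : 0 < θ₂ := (zero_lt_one.trans hθ₁).trans_le ((hV 0).1.trans (hV 0).2)
  set K := √(2 + 4 * B * Kl / c) with hK
  set C₃ := 1 + |Real.log c| with hC₃
  obtain ⟨Cr, hCr0, hCr⟩ := exists_balance_le_rate (τ := τ) hν (C₁ := (Cb / b') ^ 2) (C₂ := Kv)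
    (C₃ := C₃) (by positivity) hKv0 (by positivity) hϑ
  set VM := varSum D.eig (q (α M)) with hVM
  have hVM0 : 0 < VM := hfam.pos M
  have hV00 := hfam.pos 0
  have hθγ : θ₁ ^ (-γ) < 1 := Real.rpow_lt_one_of_one_lt_of_neg hθ₁ (by linarith)
  set A₁ := 2 * (K + β + b') ^ 2 + 130 with hA₁
  set A₂ := (2 * b' ^ 2 + 66) * varSum D.eig (q (α 0)) / (1 - θ₁ ^ (-γ)) with hA₂
  have hA₂0 : 0 < A₂ := div_pos (by positivity) (by linarith)
  have hw : 2 * ν / (2 * ν + 1) < 1 := by rw [div_lt_one (by positivity)]; linarith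
  -- small noise levels
  have hev : ∀ᶠ s in 𝓝[>] (0 : ℝ), (1 ≤ -Real.log s ∧ s * VM < 1) ∧
      s ^ (1 : ℝ) * (-Real.log s) ^ (1 : ℝ) ≤ rate ν τ ϑ s ∧
      s ^ (1 : ℝ) * (-Real.log s) ^ (0 : ℝ) ≤ rate ν τ ϑ s ∧
      ∀ α v, 0 < α → α ≤ Real.exp (-1) → 0 < v →
      v ≤ (Cb / b') ^ 2 * indexFun ν τ α ^ 2 → v ≤ Kv * (s * ((-Real.log α) ^ (1 / ϑ) / α)) →
      -Real.log α ≤ C₃ * -Real.log s → v ≤ Cr * rate ν τ ϑ s := by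
    refine ((tendsto_neg_log_nhdsGT_zero.eventually_ge_atTop 1).and ?_).and
      ((eventually_rpow_mul_log_rpow_le_rate hw τ ϑ 1).and
        ((eventually_rpow_mul_log_rpow_le_rate hw τ ϑ 0).and hCr))
    have h1 : Filter.Tendsto (fun s : ℝ => s * VM) (𝓝[>] 0) (𝓝 0) := by
      have := (Filter.tendsto_id (x := 𝓝 (0 : ℝ))).mul_const VM
      rw [zero_mul] at this
      exact this.mono_left nhdsWithin_le_nhds
    exact h1.eventually (gt_mem_nhds one_pos)
  have hsq : Filter.Tendsto (fun σ : ℝ => σ ^ 2) (𝓝[>] 0) (𝓝[>] 0) := by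
    refine tendsto_nhdsWithin_iff.2 ⟨?_, ?_⟩
    · have : Filter.Tendsto (fun σ : ℝ => σ ^ 2) (𝓝 0) (𝓝 (0 ^ 2)) := (continuous_pow 2).tendsto 0
      rw [zero_pow two_ne_zero] at this
      exact this.mono_left nhdsWithin_le_nhds
    · filter_upwards [self_mem_nhdsWithin] with σ hσ
      exact pow_pos (show (0 : ℝ) < σ from hσ) 2
  obtain ⟨σ₁, hσ₁, hσ₁'⟩ := mem_nhdsGT_iff_exists_Ioo_subset.1 (hsq.eventually hev)
  have hσ₁0 : (0 : ℝ) < σ₁ := hσ₁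
  refine ⟨A₁ * (VM + θ₂ * Cr) + A₂ * Kn, by positivity, min σ₁ (1 / 2),
    ⟨by positivity, (min_le_right _ _).trans_lt (by norm_num)⟩, ?_⟩
  intro σ hσ Ω _ P _ ξ hξ
  have hσ0 : 0 < σ := hσ.1
  obtain ⟨⟨hΛ1, hsVM⟩, hr1, hr0, hbal⟩ := hσ₁' ⟨hσ0, hσ.2.trans_le (min_le_left _ _)⟩
  rw [Real.rpow_one, Real.rpow_one] at hr1
  rw [Real.rpow_one, Real.rpow_zero, mul_one] at hr0
  set s := σ ^ 2 with hs
  have hs0 : 0 < s := by positivity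
  have hMN : M < mMax D.eig q α σ := by
    by_contra hlt
    have h1 := hfam.one_le_mMax hσ0
    have h2 := mul_le_mul_of_nonneg_left (hfam.varSum_mono (not_lt.1 hlt)) hs0.le
    exact absurd (h1.trans h2) (not_le.2 hsVM)
  -- the oracle index
  have hex : ∃ m, M ≤ m ∧ Cb * indexFun ν τ (α m) ≤ b' * √(s * varSum D.eig (q (α m))) := by
    refine ⟨mMax D.eig q α σ, hMN.le, (hM _ hMN.le).2.2.le.trans ?_⟩
    exact le_mul_of_one_le_right hb'0.le (Real.one_le_sqrt.2 (hfam.one_le_mMax hσ0))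
  classical
  set n := Nat.find hex with hn
  obtain ⟨hMn, hbn⟩ := Nat.find_spec hex
  have hnN : n ≤ mMax D.eig q α σ := Nat.find_min' hex ⟨hMN.le, (hM _ hMN.le).2.2.le.trans
    (le_mul_of_one_le_right hb'0.le (Real.one_le_sqrt.2 (hfam.one_le_mMax hσ0)))⟩
  have hrate0 : 0 < rate ν τ ϑ s := hs0.trans_le hr0
  have hvn : s * varSum D.eig (q (α n)) ≤ (VM + θ₂ * Cr) * rate ν τ ϑ s := by
    -- If the oracle is the cutoff itself, its variance is of order `s`, which the rate dominates.
    -- Otherwise its predecessor violates the balance and carries the estimate.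
    rcases hMn.eq_or_lt with heq | hlt
    · have h1 : s * varSum D.eig (q (α n)) ≤ VM * rate ν τ ϑ s := by
        rw [hn, ← heq, mul_comm]
        exact mul_le_mul_of_nonneg_left hr0 hVM0.le
      have h2 : 0 ≤ θ₂ * Cr * rate ν τ ϑ s := by positivity
      linarith
    · obtain ⟨j, hj⟩ : ∃ j, n = j + 1 := ⟨n - 1, by omega⟩
      have hMj : M ≤ j := by omega
      have hjmin : ¬ (M ≤ j ∧ Cb * indexFun ν τ (α j) ≤ b' * √(s * varSum D.eig (q (α j)))) :=
        Nat.find_min hex (by omega)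
      have hjlt : b' * √(s * varSum D.eig (q (α j))) < Cb * indexFun ν τ (α j) := by
        by_contra hcon
        exact hjmin ⟨hMj, not_lt.1 hcon⟩
      have hVj := hfam.pos j
      set v := s * varSum D.eig (q (α j)) with hv
      have hv0 : 0 < v := mul_pos hs0 hVj
      have hL1 : 1 ≤ -Real.log (α j) := by
        have := Real.log_le_log (hαpos j) (hαM' j hMj)
        rw [Real.log_exp] at this
        linarith
      have hvj : v ≤ Cr * rate ν τ ϑ s := by
        refine hbal (α j) v (hαpos j) (hαM' j hMj) hv0 ?_ ?_ ?_
        · have h1 : √v ≤ Cb / b' * indexFun ν τ (α j) := by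
            rw [div_mul_eq_mul_div, le_div_iff₀ hb'0, mul_comm]
            exact hjlt.le
          have h2 := pow_le_pow_left₀ (Real.sqrt_nonneg v) h1 2
          rwa [Real.sq_sqrt hv0.le, mul_pow] at h2
        · have h1 := hKv (α j) (q (α j)) (hαpos j) (hαM' j hMj) (hfam.filter j).nonneg
            (hB _ (hαA j)) (hfam.filter j).mul_le_one
          calc v ≤ s * (Kv * (-Real.log (α j)) ^ (1 / ϑ) / α j) :=
                mul_le_mul_of_nonneg_left h1 hs0.le
            _ = _ := by ring
        · have h1 : v < 1 := IsGeometricFamily.lt_one_of_lt_mMax (by omega)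
          -- From `s c L / α ≤ v < 1` and `L ≥ 1`; taking logarithms bounds `log (1/α)` by a
          -- multiple of `log (1/s)`, with `C₃` absorbing `|log c|`.
          have h2 : s * c < α j := by
            have h3 := mul_le_mul_of_nonneg_left (hM j hMj).1 hs0.le
            have h4 : s * (c * (-Real.log (α j) / α j)) < 1 := h3.trans_lt h1
            have h5 : s * (c * (-Real.log (α j) / α j)) = s * c * -Real.log (α j) / α j := by ring
            rw [h5, div_lt_one (hαpos j)] at h4
            have h6 : s * c ≤ s * c * -Real.log (α j) :=
              le_mul_of_one_le_right (by positivity) hL1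
            linarith
          have h7 := Real.log_lt_log (by positivity) h2
          rw [Real.log_mul hs0.ne' hc0.ne'] at h7
          have h8 := neg_abs_le (Real.log c)
          have h9 := abs_nonneg (Real.log c)
          have h10 := le_mul_of_one_le_right h9 hΛ1
          rw [hC₃, add_mul, one_mul]
          linarith only [h7, h8, h10]
      have h1 : s * varSum D.eig (q (α n)) ≤ θ₂ * v := by
        rw [hj, hv]
        have := mul_le_mul_of_nonneg_left (hV2 j) hs0.le
        linarith
      have h2 : θ₂ * v ≤ θ₂ * (Cr * rate ν τ ϑ s) := mul_le_mul_of_nonneg_left hvj hθ₂.le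
      have h3 : 0 ≤ VM * rate ν τ ϑ s := by positivity
      linarith
  refine iSup₂_le fun f hf => ?_
  have hbias : ‖residual D (q (α n)) f‖ ≤ b' * √(σ ^ 2 * varSum D.eig (q (α n))) :=
    (hCb f hf _ (hαA n) (hαM n hMn)).trans hbn
  refine (hfam.solitMSE_le hξ hσ0 hβ.le hγ (Real.sqrt_nonneg _) hb' hnN (by omega) hbias
    fun m hm => hfam.critValue_le hξ hγ hσ0 hB0 hc0 hKl0.le hm (hαpos n) (hB _ (hαA n))
      (hKl σ hσ0 n (hαM' n hMn)) (hM n hMn).1).trans ?_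
  refine ENNReal.ofReal_le_ofReal ?_
  have h1 : A₁ * (s * varSum D.eig (q (α n))) ≤ A₁ * ((VM + θ₂ * Cr) * rate ν τ ϑ s) :=
    mul_le_mul_of_nonneg_left hvn (by positivity)
  have h2 : A₂ * (s * mMax D.eig q α σ) ≤ A₂ * (Kn * rate ν τ ϑ s) := by
    refine mul_le_mul_of_nonneg_left ?_ hA₂0.le
    calc s * (mMax D.eig q α σ : ℝ) ≤ s * (Kn * -Real.log s) :=
          mul_le_mul_of_nonneg_left (hKn σ hσ0 hΛ1) hs0.le
      _ = Kn * (s * -Real.log s) := by ring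
      _ ≤ _ := mul_le_mul_of_nonneg_left hr1 hKn0.le
  have h3 : (A₁ * (VM + θ₂ * Cr) + A₂ * Kn) * s ^ (2 * ν / (2 * ν + 1)) *
      (-Real.log s) ^ ((2 * ν / ϑ - 2 * τ) / (2 * ν + 1))
      = A₁ * ((VM + θ₂ * Cr) * rate ν τ ϑ s) + A₂ * (Kn * rate ν τ ϑ s) := by
    rw [rate]; ring
  rw [h3]
  exact add_le_add h1 h2
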